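/- Let $n\ge 0$ be an integer and $\eta\in\mathbb R$. For $\mathbb K\in\{\mathbb R,\mathbb C\}$ let $BUC_\eta(\mathbb K^n)$ be the Banach space of continuous $\varphi:(-\infty,0]\to\mathbb K^n$ for which $\theta\mapsto e^{\eta\theta}\varphi(\theta)$ is bounded and uniformly continuous, with norm $\|\varphi\|_\eta=\sup_{\theta\le 0}e^{\eta\theta}\|\varphi(\theta)\|$. Let $\widehat L:BUC_\eta(\mathbb R^n)\to\mathbb R^n$ be bounded and linear, and denote its complex-linear extension $BUC_\eta(\mathbb C^n)\to\mathbb C^n$ by $\widehat L$ too. On $X=\mathbb C^n\times BUC_\eta(\mathbb C^n)$ consider the operator $$(A+L)\begin{pmatrix}0\\ \varphi\end{pmatrix}=\begin{pmatrix}-\varphi'(0)+\widehat L(\varphi)\\ \varphi'\end{pmatrix},\qquad D(A+L)=D(A)=\{0\}\times\{\varphi\in C^1:\ \varphi,\varphi'\in BUC_\eta(\mathbb C^n)\}.$$ For $\operatorname{Re}\lambda>-\eta$ let $\Delta(\lambda)=\lambda I-\widehat L(e^{\lambda\cdot}I)\in M_n(\mathbb C)$, where for a scalar function $k$ the $j$-th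 column of $\widehat L(kI)$ is $\widehat L(k\,e_j)$. Call $\lambda_0$ a simple eigenvalue of $A+L$ if it is an isolated point of $\sigma(A+L)$, a pole of order $1$ of the resolvent $(\lambda I-(A+L))^{-1}$, and its eigenspace $N(\lambda_0I-(A+L))$ is one-dimensional. Let $\operatorname{Re}\lambda_0>-\eta$. Then $\lambda_0$ is a simple eigenvalue of $A+L$ if and only if $$\lim_{\lambda\to\lambda_0}(\lambda-\lambda_0)^2\Delta(\lambda)^{-1}=0\quad\text{and}\quad \dim N(\Delta(\lambda_0))=1 .$$ In that case the limit $\Delta_{-1}=\lim_{\lambda\to\lambda_0}(\lambda-\lambda_0)\Delta(\lambda)^{-1}$ exists, and there are $V,W\in\mathbb C^n\setminus\{0\}$ with $$W^T\Delta(\lambda_0)=0,\qquad \Delta(\lambda_0)V=0,\qquad \Delta_{-1}=VW^T,\qquad \Delta_{-1}=\Delta_{-1}\Big[I+\widehat L\Big(\theta\mapsto\int_\theta^0e^{\lambda_0\theta}\,ds\; I\Big)\Big]\Delta_{-1};$$ conversely, if $V,W\in\mathbb C^n\setminus\{0\}$ satisfy $W^T\Delta(\lambda_0)=0$ and $\Delta(\lambda_0)V=0$,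 and $M=VW^T$ satisfies $M=M\big[I+\widehat L\big(\theta\mapsto\int_\theta^0e^{\lambda_0\theta}\,ds\;I\big)\big]M$, then $M=\Delta_{-1}$. Moreover, the coefficient $B_{-1}^{\lambda_0}$ of $(\lambda-\lambda_0)^{-1}$ in the Laurent expansion of $(\lambda I-(A+L))^{-1}$ at $\lambda_0$ is a projector of $X$ with range the eigenspace $N(\lambda_0I-(A+L))$, and it is given, for all $(\alpha,\varphi)\in X$, by $$B_{-1}^{\lambda_0}\begin{pmatrix}\alpha\\ \varphi\end{pmatrix}=\begin{pmatrix}0\\ \psi\end{pmatrix},\qquad \psi(\theta)=e^{\lambda_0\theta}\,\Delta_{-1}\Big[\alpha+\varphi(0)+\widehat L\Big(\vartheta\mapsto\int_\vartheta^0e^{\lambda_0(\vartheta-s)}\varphi(s)\,ds\Big)\Big].$$ -/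

import Mathlib

open Filter Topology Set

noncomputable section

namespace DelayEquation

/-! ### The weighted space of uniformly continuous functions on the negative half line -/

/-- The functions `φ : (-∞, 0] → E` that are continuous and for which `θ ↦ e^{ηθ} φ(θ)` is bounded
and uniformly continuous, as an additive group of functions. -/
def bucAddSubgroup (η : ℝ) (E : Type*) [NormedAddCommGroup E] [NormedSpace ℝ E] :
    AddSubgroup (Iic (0 : ℝ) → E) where
  carrier := {φ | Continuous φ ∧
    (∃ C : ℝ, ∀ θ : Iic (0 : ℝ), ‖Real.exp (η * θ) • φ θ‖ ≤ C) ∧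
    UniformContinuous fun θ : Iic (0 : ℝ) => Real.exp (η * θ) • φ θ}
  zero_mem' := by
    refine ⟨continuous_zero, ⟨0, fun θ => by simp⟩, ?_⟩
    simpa using (uniformContinuous_const : UniformContinuous fun _ : Iic (0 : ℝ) => (0 : E))
  add_mem' := by
    rintro φ ψ ⟨h1, ⟨C, h2⟩, h3⟩ ⟨k1, ⟨D, k2⟩, k3⟩
    refine ⟨h1.add k1, ⟨C + D, fun θ => ?_⟩, ?_⟩
    · rw [Pi.add_apply, smul_add]
      exact (norm_add_le _ _).trans (add_le_add (h2 θ) (k2 θ))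
    · simpa [smul_add] using h3.add k3
  neg_mem' := by
    rintro φ ⟨h1, ⟨C, h2⟩, h3⟩
    refine ⟨h1.neg, ⟨C, fun θ => ?_⟩, ?_⟩
    · rw [Pi.neg_apply, smul_neg, norm_neg]
      exact h2 θ
    · simpa [smul_neg] using h3.neg

/-- The space `BUC_η` of functions `(-∞, 0] → E`, with its weighted supremum norm (below). It is a
type of its own, so that it does not inherit the topology of pointwise convergence. -/
def BUC (η : ℝ) (E : Type*) [NormedAddCommGroup E] [NormedSpace ℝ E] : Type _ :=
  ↥(bucAddSubgroup η E)

namespace BUC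

variable {η : ℝ} {E F : Type*} [NormedAddCommGroup E] [NormedSpace ℝ E]
  [NormedAddCommGroup F] [NormedSpace ℝ F]

instance : AddCommGroup (BUC η E) := inferInstanceAs (AddCommGroup ↥(bucAddSubgroup η E))

instance : CoeFun (BUC η E) (fun _ => Iic (0 : ℝ) → E) := ⟨fun φ => φ.1⟩

@[ext] theorem ext {φ ψ : BUC η E} (h : ∀ θ, φ θ = ψ θ) : φ = ψ := Subtype.ext (funext h)

@[simp] theorem add_apply (φ ψ : BUC η E) (θ : Iic (0 : ℝ)) : (φ + ψ) θ = φ θ + ψ θ := rfl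

@[simp] theorem zero_apply (θ : Iic (0 : ℝ)) : (0 : BUC η E) θ = 0 := rfl

theorem continuous (φ : BUC η E) : Continuous φ := φ.2.1

/-- Composition with a bounded linear map `E → F` of the values. -/
def map (T : E →L[ℝ] F) (φ : BUC η E) : BUC η F :=
  ⟨fun θ => T (φ θ), by
    obtain ⟨h1, ⟨C, h2⟩, h3⟩ := φ.2
    refine ⟨T.continuous.comp h1, ⟨‖T‖ * C, fun θ => ?_⟩, ?_⟩
    · rw [← map_smul]
      exact (T.le_opNorm _).trans (mul_le_mul_of_nonneg_left (h2 θ) (norm_nonneg _))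
    · simpa [Function.comp_def, map_smul] using T.uniformContinuous.comp h3⟩

@[simp] theorem map_apply (T : E →L[ℝ] F) (φ : BUC η E) (θ : Iic (0 : ℝ)) :
    map T φ θ = T (φ θ) := rfl

section Scalar

variable {𝕜 : Type*} [NormedField 𝕜] [NormedSpace 𝕜 E] [SMulCommClass ℝ 𝕜 E]

instance : SMul 𝕜 (BUC η E) where
  smul c φ := ⟨fun θ => c • φ θ, by
    obtain ⟨h1, ⟨C, h2⟩, h3⟩ := φ.2
    refine ⟨h1.const_smul c, ⟨‖c‖ * C, fun θ => ?_⟩, ?_⟩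
    · rw [smul_comm, norm_smul]
      exact mul_le_mul_of_nonneg_left (h2 θ) (norm_nonneg _)
    · simp only [smul_comm _ c]
      exact h3.const_smul c⟩

@[simp] theorem smul_apply (c : 𝕜) (φ : BUC η E) (θ : Iic (0 : ℝ)) : (c • φ) θ = c • φ θ := rfl

instance : Module 𝕜 (BUC η E) where
  one_smul φ := ext fun θ => one_smul 𝕜 (φ θ)
  mul_smul a b φ := ext fun θ => mul_smul a b (φ θ)
  smul_zero a := ext fun _ => smul_zero a
  smul_add a φ ψ := ext fun θ => smul_add a (φ θ) (ψ θ)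
  add_smul a b φ := ext fun θ => add_smul a b (φ θ)
  zero_smul φ := ext fun θ => zero_smul 𝕜 (φ θ)

end Scalar

/-- The norm `‖φ‖_η = sup_{θ ≤ 0} e^{ηθ} ‖φ(θ)‖`. -/
instance : Norm (BUC η E) := ⟨fun φ => ⨆ θ : Iic (0 : ℝ), Real.exp (η * θ) * ‖φ θ‖⟩

theorem norm_def (φ : BUC η E) : ‖φ‖ = ⨆ θ : Iic (0 : ℝ), Real.exp (η * θ) * ‖φ θ‖ := rfl

theorem bddAbove_range (φ : BUC η E) :
    BddAbove (range fun θ : Iic (0 : ℝ) => Real.exp (η * θ) * ‖φ θ‖) := by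
  obtain ⟨C, hC⟩ := φ.2.2.1
  refine ⟨C, ?_⟩
  rintro _ ⟨θ, rfl⟩
  simpa [norm_smul] using hC θ

theorem weight_mul_norm_le (φ : BUC η E) (θ : Iic (0 : ℝ)) :
    Real.exp (η * θ) * ‖φ θ‖ ≤ ‖φ‖ := le_ciSup φ.bddAbove_range θ

instance : Nonempty (Iic (0 : ℝ)) := ⟨⟨0, mem_Iic.2 le_rfl⟩⟩

theorem norm_smul_le' {𝕜 : Type*} [NormedField 𝕜] [NormedSpace 𝕜 E] [SMulCommClass ℝ 𝕜 E]
    (c : 𝕜) (φ : BUC η E) : ‖c • φ‖ ≤ ‖c‖ * ‖φ‖ := by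
  refine ciSup_le fun θ => ?_
  have h := mul_le_mul_of_nonneg_left (φ.weight_mul_norm_le θ) (norm_nonneg c)
  rw [smul_apply, norm_smul]
  linarith

theorem normCore : NormedSpace.Core ℝ (BUC η E) where
  norm_nonneg φ := Real.iSup_nonneg fun θ => by positivity
  norm_smul c φ := by
    refine le_antisymm (norm_smul_le' c φ) ?_
    rw [norm_def φ, Real.mul_iSup_of_nonneg (norm_nonneg c)]
    refine ciSup_le fun θ => ?_
    have h := (c • φ).weight_mul_norm_le θ
    rw [smul_apply, norm_smul] at h
    linarith
  norm_triangle φ ψ := by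
    refine ciSup_le fun θ => ?_
    have h1 := φ.weight_mul_norm_le θ
    have h2 := ψ.weight_mul_norm_le θ
    have h3 := mul_le_mul_of_nonneg_left (norm_add_le (φ θ) (ψ θ)) (Real.exp_pos (η * θ)).le
    rw [add_apply]
    linarith
  norm_eq_zero_iff φ := by
    constructor
    · intro h
      ext θ
      have h1 := φ.weight_mul_norm_le θ
      rw [h] at h1
      have h2 : ‖φ θ‖ ≤ 0 := nonpos_of_mul_nonpos_right h1 (Real.exp_pos _)
      simpa using h2
    · rintro rfl
      simp [norm_def]

instance : NormedAddCommGroup (BUC η E) := NormedAddCommGroup.ofCore normCore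

instance {𝕜 : Type*} [NormedField 𝕜] [NormedSpace 𝕜 E] [SMulCommClass ℝ 𝕜 E] :
    NormedSpace 𝕜 (BUC η E) where
  norm_smul_le := norm_smul_le'

/-- A differentiable function with `e^{ηθ} f(θ)` and `e^{ηθ} f'(θ)` bounded belongs to `BUC_η`. -/
theorem mem_of_hasDerivAt (f f' : ℝ → E) (C C' : ℝ) (hd : ∀ θ, HasDerivAt f (f' θ) θ)
    (hC : ∀ θ ≤ 0, Real.exp (η * θ) * ‖f θ‖ ≤ C)
    (hC' : ∀ θ ≤ 0, Real.exp (η * θ) * ‖f' θ‖ ≤ C') :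
    (fun θ : Iic (0 : ℝ) => f θ) ∈ bucAddSubgroup η E := by
  have hf : Continuous f := continuous_iff_continuousAt.2 fun θ => (hd θ).continuousAt
  refine ⟨hf.comp continuous_subtype_val, ⟨C, fun θ => ?_⟩, ?_⟩
  · rw [norm_smul, Real.norm_of_nonneg (Real.exp_pos _).le]
    exact hC θ θ.2
  · have hg : ∀ θ : ℝ, HasDerivAt (fun θ : ℝ => Real.exp (η * θ) • f θ)
        (Real.exp (η * θ) • f' θ + (Real.exp (η * θ) * η) • f θ) θ := by
      intro θ
      have h1 : HasDerivAt (fun θ : ℝ => Real.exp (η * θ)) (Real.exp (η * θ) * η) θ := by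
        simpa using ((hasDerivAt_id θ).const_mul η).exp
      exact h1.smul (hd θ)
    have hb : ∀ θ ∈ Iic (0 : ℝ),
        ‖Real.exp (η * θ) • f' θ + (Real.exp (η * θ) * η) • f θ‖ ≤ C' + |η| * C := by
      intro θ hθ
      refine (norm_add_le _ _).trans (add_le_add ?_ ?_)
      · rw [norm_smul, Real.norm_of_nonneg (Real.exp_pos _).le]
        exact hC' θ hθ
      · rw [norm_smul, norm_mul, Real.norm_of_nonneg (Real.exp_pos _).le, Real.norm_eq_abs]
        have := mul_le_mul_of_nonneg_left (hC θ hθ) (abs_nonneg η)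
        linarith
    have hl : LipschitzWith (Real.toNNReal (C' + |η| * C))
        (fun θ : Iic (0 : ℝ) => Real.exp (η * θ) • f θ) := by
      refine LipschitzWith.of_dist_le_mul fun x y => ?_
      have h := (convex_Iic (0 : ℝ)).norm_image_sub_le_of_norm_hasDerivWithin_le
        (fun θ _ => (hg θ).hasDerivWithinAt) hb y.2 x.2
      rw [dist_eq_norm, Subtype.dist_eq, dist_eq_norm]
      exact h.trans (mul_le_mul_of_nonneg_right (Real.le_coe_toNNReal _) (norm_nonneg _))
    exact hl.uniformContinuous

end BUC

/-- The point `0` of `(-∞, 0]`. -/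
def zeroPt : Iic (0 : ℝ) := ⟨0, mem_Iic.2 le_rfl⟩

/-! ### Exponentials and convolutions in `BUC_η((-∞, 0], ℂⁿ)` -/

section Elements

variable {η : ℝ} {n : ℕ}

theorem hasDerivAt_cexp_mul (z : ℂ) (θ : ℝ) :
    HasDerivAt (fun θ : ℝ => Complex.exp (z * θ)) (z * Complex.exp (z * θ)) θ := by
  have h : HasDerivAt (fun w : ℂ => Complex.exp (z * w)) (Complex.exp (z * θ) * z) (θ : ℂ) := by
    simpa using ((hasDerivAt_id (θ : ℂ)).const_mul z).cexp
  rw [mul_comm]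
  exact h.comp_ofReal

theorem weight_mul_norm_cexp (z : ℂ) (θ s : ℝ) :
    Real.exp (η * θ) * ‖Complex.exp (z * (θ - s))‖
      = Real.exp ((z.re + η) * (θ - s)) * Real.exp (η * s) := by
  rw [Complex.norm_exp, ← Real.exp_add, ← Real.exp_add]
  congr 1
  simp
  ring

/-- The function `θ ↦ e^{zθ} x`, which belongs to `BUC_η` for `Re z > -η`. -/
def expFun {z : ℂ} (hz : -η < z.re) (x : Fin n → ℂ) : BUC η (Fin n → ℂ) :=
  ⟨fun θ => Complex.exp (z * (θ : ℝ)) • x, by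
    have hb : ∀ θ ≤ (0 : ℝ), Real.exp (η * θ) * ‖Complex.exp (z * θ)‖ ≤ 1 := by
      intro θ hθ
      have h := weight_mul_norm_cexp (η := η) z θ 0
      simp only [Complex.ofReal_zero, sub_zero, mul_zero, Real.exp_zero, mul_one] at h
      rw [h]
      exact Real.exp_le_one_iff.2 (mul_nonpos_of_nonneg_of_nonpos (by linarith) hθ)
    refine BUC.mem_of_hasDerivAt (fun θ : ℝ => Complex.exp (z * θ) • x)
      (fun θ : ℝ => (z * Complex.exp (z * θ)) • x) ‖x‖ (‖z‖ * ‖x‖)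
      (fun θ => (hasDerivAt_cexp_mul z θ).smul_const x) (fun θ hθ => ?_) (fun θ hθ => ?_)
    · rw [norm_smul, ← mul_assoc]
      exact mul_le_of_le_one_left (norm_nonneg _) (hb θ hθ)
    · rw [norm_smul, norm_mul]
      have h := mul_le_mul_of_nonneg_right (hb θ hθ) (mul_nonneg (norm_nonneg z) (norm_nonneg x))
      linarith⟩

theorem continuous_extend (φ : BUC η (Fin n → ℂ)) : Continuous (IicExtend φ) := by
  refine φ.continuous.comp ?_
  exact Continuous.subtype_mk (by fun_prop) _

/-- The value at `θ` of the convolution `∫_θ^0 e^{z(θ-s)} φ(s) ds`. -/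
def convValue (z : ℂ) (φ : BUC η (Fin n → ℂ)) (θ : ℝ) : Fin n → ℂ :=
  ∫ s in θ..0, Complex.exp (z * (θ - s)) • IicExtend φ s

theorem weight_mul_norm_convValue {z : ℂ} (hz : -η < z.re) (φ : BUC η (Fin n → ℂ)) {θ : ℝ}
    (hθ : θ ≤ 0) : Real.exp (η * θ) * ‖convValue z φ θ‖ ≤ ‖φ‖ / (z.re + η) := by
  have hμ : 0 < z.re + η := by linarith
  have hle : ∀ s ∈ Ioc θ 0, ‖Real.exp (η * θ) • (Complex.exp (z * (θ - s)) • IicExtend φ s)‖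
      ≤ ‖φ‖ * Real.exp ((z.re + η) * (θ - s)) := by
    intro s hs
    have hs0 : s ∈ Iic (0 : ℝ) := hs.2
    rw [IicExtend_of_mem _ hs0, norm_smul, norm_smul, Real.norm_of_nonneg (Real.exp_pos _).le,
      ← mul_assoc, weight_mul_norm_cexp, mul_assoc, mul_comm]
    exact mul_le_mul_of_nonneg_right (φ.weight_mul_norm_le ⟨s, hs0⟩) (Real.exp_pos _).le
  have hint : ∫ s in θ..0, ‖φ‖ * Real.exp ((z.re + η) * (θ - s))
      = ‖φ‖ * ((1 - Real.exp ((z.re + η) * θ)) / (z.re + η)) := by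
    rw [intervalIntegral.integral_const_mul]
    congr 1
    have hd : ∀ s ∈ uIcc θ 0, HasDerivAt
        (fun s : ℝ => -(Real.exp ((z.re + η) * (θ - s)) / (z.re + η)))
        (Real.exp ((z.re + η) * (θ - s))) s := by
      intro s _
      have h1 := (((hasDerivAt_id s).const_sub θ).const_mul (z.re + η)).exp
      have h2 := (h1.div_const (z.re + η)).neg
      refine h2.congr_deriv ?_
      simp only [id_eq]
      field_simp
    rw [intervalIntegral.integral_eq_sub_of_hasDerivAt hd
      (Continuous.intervalIntegrable (by fun_prop) _ _)]
    simp
    ring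
  have h1 : Real.exp (η * θ) * ‖convValue z φ θ‖
      = ‖∫ s in θ..0, Real.exp (η * θ) • (Complex.exp (z * (θ - s)) • IicExtend φ s)‖ := by
    rw [intervalIntegral.integral_smul, norm_smul, Real.norm_of_nonneg (Real.exp_pos _).le]
    rfl
  rw [h1]
  refine (intervalIntegral.norm_integral_le_of_norm_le hθ (Eventually.of_forall hle)
    (Continuous.intervalIntegrable (by fun_prop) _ _)).trans ?_
  rw [hint, ← mul_div_assoc]
  refine div_le_div_of_nonneg_right ?_ hμ.le
  have := Real.exp_pos ((z.re + η) * θ)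
  nlinarith [norm_nonneg φ]

theorem hasDerivAt_convValue (z : ℂ) (φ : BUC η (Fin n → ℂ)) (θ : ℝ) :
    HasDerivAt (convValue z φ) (z • convValue z φ θ - IicExtend φ θ) θ := by
  have hfac : ∀ θ : ℝ, convValue z φ θ
      = Complex.exp (z * θ) • ∫ s in θ..0, Complex.exp (-(z * s)) • IicExtend φ s := by
    intro θ
    rw [convValue, ← intervalIntegral.integral_smul]
    congr 1
    ext1 s
    rw [smul_smul, ← Complex.exp_add]
    congr 2
    ring
  have hc : Continuous fun s : ℝ => Complex.exp (-(z * s)) • IicExtend φ s :=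
    by
    have h : Continuous fun s : ℝ => Complex.exp (-(z * s)) := by fun_prop
    exact h.smul (continuous_extend φ)
  have h1 : HasDerivAt (fun θ : ℝ => ∫ s in θ..0, Complex.exp (-(z * s)) • IicExtend φ s)
      (-(Complex.exp (-(z * θ)) • IicExtend φ θ)) θ :=
    intervalIntegral.integral_hasDerivAt_left (hc.intervalIntegrable _ _)
      (hc.stronglyMeasurableAtFilter _ _) hc.continuousAt
  have h2 := (hasDerivAt_cexp_mul z θ).smul h1
  rw [funext hfac]
  refine h2.congr_deriv ?_
  rw [smul_neg, smul_smul, ← Complex.exp_add, smul_smul]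
  simp only [add_neg_cancel, Complex.exp_zero, one_smul]
  abel

/-- The function `θ ↦ ∫_θ^0 e^{z(θ-s)} φ(s) ds`, which belongs to `BUC_η` for `Re z > -η`. -/
def convFun {z : ℂ} (hz : -η < z.re) (φ : BUC η (Fin n → ℂ)) : BUC η (Fin n → ℂ) :=
  ⟨fun θ => ∫ s in (θ : ℝ)..0, Complex.exp (z * ((θ : ℝ) - s)) • IicExtend φ s, by
    refine BUC.mem_of_hasDerivAt (convValue z φ) _ (‖φ‖ / (z.re + η))
      (‖z‖ * (‖φ‖ / (z.re + η)) + ‖φ‖) (hasDerivAt_convValue z φ)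
      (fun θ hθ => weight_mul_norm_convValue hz φ hθ) (fun θ hθ => ?_)
    have h1 := weight_mul_norm_convValue hz φ hθ
    have hθ' : θ ∈ Iic (0 : ℝ) := hθ
    have h2 := φ.weight_mul_norm_le ⟨θ, hθ'⟩
    have h3 : ‖z • convValue z φ θ - IicExtend φ θ‖
        ≤ ‖z‖ * ‖convValue z φ θ‖ + ‖φ ⟨θ, hθ'⟩‖ := by
      rw [IicExtend_of_mem _ hθ', ← norm_smul]
      exact norm_sub_le _ _
    have h4 := mul_le_mul_of_nonneg_left h3 (Real.exp_pos (η * θ)).le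
    have h5 := mul_le_mul_of_nonneg_left h1 (norm_nonneg z)
    simp only at h2
    linarith⟩

/-- The function `θ ↦ (∫_θ^0 e^{zθ} ds) x`, which belongs to `BUC_η` for `Re z > -η`. -/
def tailFun {z : ℂ} (hz : -η < z.re) (x : Fin n → ℂ) : BUC η (Fin n → ℂ) :=
  ⟨fun θ => (∫ _s in (θ : ℝ)..0, Complex.exp (z * (θ : ℝ))) • x, by
    have h : (fun θ : Iic (0 : ℝ) => (∫ _s in (θ : ℝ)..0, Complex.exp (z * (θ : ℝ))) • x)
        = fun θ => convFun hz (expFun hz x) θ := by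
      funext θ
      change _ = ∫ s in (θ : ℝ)..0, Complex.exp (z * ((θ : ℝ) - s)) • IicExtend (expFun hz x) s
      rw [← intervalIntegral.integral_smul_const]
      refine intervalIntegral.integral_congr fun s hs => ?_
      rw [uIcc_of_le θ.2] at hs
      have hs0 : s ∈ Iic (0 : ℝ) := hs.2
      simp only [IicExtend_of_mem _ hs0]
      change _ = Complex.exp (z * ((θ : ℝ) - s)) • (Complex.exp (z * s) • x)
      rw [smul_smul, ← Complex.exp_add]
      congr 2
      ring
    rw [h]
    exact (convFun hz (expFun hz x)).2⟩

end Elements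

/-! ### The operators `A` and `L` on `X = ℂⁿ × BUC_η` -/

section Operators

variable (η : ℝ) (n : ℕ)

/-- The (complexified) state space `X = ℂⁿ × BUC_η((-∞, 0], ℂⁿ)`. -/
abbrev StateSpace : Type := (Fin n → ℂ) × BUC η (Fin n → ℂ)

variable {η n}

/-- `ψ` is the derivative of `φ` on `(-∞, 0]` (one-sided at `0`). -/
def HasDeriv (φ ψ : BUC η (Fin n → ℂ)) : Prop :=
  ∀ θ : Iic (0 : ℝ), HasDerivWithinAt (IicExtend φ) (ψ θ) (Iic 0) θ

theorem HasDeriv.unique {φ ψ χ : BUC η (Fin n → ℂ)} (h : HasDeriv φ ψ) (k : HasDeriv φ χ) :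
    ψ = χ := by
  ext1 θ
  exact ((uniqueDiffOn_Iic (0 : ℝ)) θ θ.2).eq_deriv _ (h θ) (k θ)

theorem HasDeriv.add {φ ψ φ' ψ' : BUC η (Fin n → ℂ)} (h : HasDeriv φ ψ) (k : HasDeriv φ' ψ') :
    HasDeriv (φ + φ') (ψ + ψ') := fun θ => (h θ).add (k θ)

theorem HasDeriv.smul {φ ψ : BUC η (Fin n → ℂ)} (c : ℂ) (h : HasDeriv φ ψ) :
    HasDeriv (c • φ) (c • ψ) := fun θ => (h θ).const_smul c

theorem HasDeriv.zero : HasDeriv (0 : BUC η (Fin n → ℂ)) 0 :=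
  fun θ => hasDerivWithinAt_const (θ : ℝ) (Iic 0) (0 : Fin n → ℂ)

variable (η n) in
/-- The operator `A (0, φ) = (-φ'(0), φ')` with domain
`D(A) = {0} × {φ ∈ C¹ : φ, φ' ∈ BUC_η}`. -/
def opA : StateSpace η n →ₗ.[ℂ] StateSpace η n where
  domain :=
    { carrier := {x | x.1 = 0 ∧ ∃ ψ, HasDeriv x.2 ψ}
      zero_mem' := ⟨rfl, 0, HasDeriv.zero⟩
      add_mem' := by
        rintro x y ⟨hx, ψ, hψ⟩ ⟨hy, χ, hχ⟩
        exact ⟨by simp [hx, hy], ψ + χ, hψ.add hχ⟩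
      smul_mem' := by
        rintro c x ⟨hx, ψ, hψ⟩
        exact ⟨by simp [hx], c • ψ, hψ.smul c⟩ }
  toFun :=
    { toFun := fun x => (-(x.2.2.choose zeroPt), x.2.2.choose)
      map_add' := by
        intro x y
        have h : (x + y).2.2.choose = x.2.2.choose + y.2.2.choose :=
          (x + y).2.2.choose_spec.unique (x.2.2.choose_spec.add y.2.2.choose_spec)
        rw [h]
        refine Prod.ext ?_ rfl
        exact neg_add _ _
      map_smul' := by
        intro c x
        have h : (c • x).2.2.choose = c • x.2.2.choose :=
          (c • x).2.2.choose_spec.unique (x.2.2.choose_spec.smul c)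
        rw [h]
        refine Prod.ext ?_ rfl
        exact (smul_neg _ _).symm }

theorem opA_apply (x : (opA η n).domain) {ψ : BUC η (Fin n → ℂ)} (h : HasDeriv x.1.2 ψ) :
    opA η n x = (-(ψ zeroPt), ψ) := by
  have h1 : x.2.2.choose = ψ := x.2.2.choose_spec.unique h
  change (-(x.2.2.choose zeroPt), x.2.2.choose) = _
  rw [h1]

/-- The componentwise real part `ℂⁿ → ℝⁿ`. -/
def reMap (n : ℕ) : (Fin n → ℂ) →L[ℝ] (Fin n → ℝ) :=
  ContinuousLinearMap.pi fun j => Complex.reCLM.comp (ContinuousLinearMap.proj j)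

/-- The componentwise imaginary part `ℂⁿ → ℝⁿ`. -/
def imMap (n : ℕ) : (Fin n → ℂ) →L[ℝ] (Fin n → ℝ) :=
  ContinuousLinearMap.pi fun j => Complex.imCLM.comp (ContinuousLinearMap.proj j)

/-- The complex linear extension `Lhat(φ + iψ) = Lhat φ + i Lhat ψ` of a real bounded linear map
`Lhat : BUC_η((-∞, 0], ℝⁿ) → ℝⁿ`. -/
def complexify (Lhat : BUC η (Fin n → ℝ) →L[ℝ] (Fin n → ℝ)) :
    BUC η (Fin n → ℂ) →ₗ[ℂ] (Fin n → ℂ) where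
  toFun φ := fun j =>
    (Lhat (φ.map (reMap n)) j : ℂ) + (Lhat (φ.map (imMap n)) j : ℂ) * Complex.I
  map_add' φ ψ := by
    have h1 : (φ + ψ).map (reMap n) = φ.map (reMap n) + ψ.map (reMap n) :=
      BUC.ext fun θ => map_add (reMap n) (φ θ) (ψ θ)
    have h2 : (φ + ψ).map (imMap n) = φ.map (imMap n) + ψ.map (imMap n) :=
      BUC.ext fun θ => map_add (imMap n) (φ θ) (ψ θ)
    funext j
    simp only [h1, h2, map_add, Pi.add_apply, Complex.ofReal_add]
    ring
  map_smul' c φ := by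
    have h1 : (c • φ).map (reMap n)
        = c.re • φ.map (reMap n) + (-c.im) • φ.map (imMap n) := by
      refine BUC.ext fun θ => funext fun j => ?_
      change (c * φ θ j).re = c.re * (φ θ j).re + (-c.im) * (φ θ j).im
      rw [Complex.mul_re]
      ring
    have h2 : (c • φ).map (imMap n)
        = c.re • φ.map (imMap n) + c.im • φ.map (reMap n) := by
      refine BUC.ext fun θ => funext fun j => ?_
      change (c * φ θ j).im = c.re * (φ θ j).im + c.im * (φ θ j).re
      rw [Complex.mul_im]
    funext j
    rw [h1, h2]
    simp only [map_add, map_smul, Pi.add_apply, Pi.smul_apply, smul_eq_mul, RingHom.id_apply]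
    apply Complex.ext
    · simp
      ring
    · simp

/-- The operator `L (0, φ) = (Lhat φ, 0)` with domain `{0} × BUC_η`, the closure of `D(A)`. -/
def opL (Lhat : BUC η (Fin n → ℝ) →L[ℝ] (Fin n → ℝ)) : StateSpace η n →ₗ.[ℂ] StateSpace η n where
  domain := (⊥ : Submodule ℂ (Fin n → ℂ)).prod ⊤
  toFun := ((LinearMap.inl ℂ (Fin n → ℂ) (BUC η (Fin n → ℂ))).comp
    ((complexify Lhat).comp (LinearMap.snd ℂ (Fin n → ℂ) (BUC η (Fin n → ℂ))))).comp
      (Submodule.subtype _)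

/-- The operator `A + L`, with domain `D(A)`. -/
def opAL (Lhat : BUC η (Fin n → ℝ) →L[ℝ] (Fin n → ℝ)) : StateSpace η n →ₗ.[ℂ] StateSpace η n :=
  opA η n + opL Lhat

theorem opAL_domain (Lhat : BUC η (Fin n → ℝ) →L[ℝ] (Fin n → ℝ)) :
    (opAL Lhat).domain = (opA η n).domain := by
  change (opA η n).domain ⊓ _ = _
  refine inf_eq_left.2 fun x hx => ?_
  exact Submodule.mem_prod.2 ⟨by simpa using hx.1, trivial⟩

/-- The matrix `Lhat(k I)`, where the column number `j` of `k I` is `k e_j`. -/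
def hatMatrix (Lhat : BUC η (Fin n → ℝ) →L[ℝ] (Fin n → ℝ))
    (k : (Fin n → ℂ) → BUC η (Fin n → ℂ)) : Matrix (Fin n) (Fin n) ℂ :=
  Matrix.of fun i j => complexify Lhat (k (Pi.single j 1)) i

open scoped Classical in
/-- The characteristic matrix `Δ(z) = z I - Lhat(e^{z·} I)`, for `Re z > -η`. Outside of this half
plane, where `e^{z·}` need not belong to `BUC_η`, the value is irrelevant and set to `0`. -/
def charMatrix (Lhat : BUC η (Fin n → ℝ) →L[ℝ] (Fin n → ℝ)) (z : ℂ) :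
    Matrix (Fin n) (Fin n) ℂ :=
  if hz : -η < z.re then z • (1 : Matrix (Fin n) (Fin n) ℂ) - hatMatrix Lhat (expFun hz) else 0

end Operators

/-! ### Spectrum, poles of the resolvent, and simple eigenvalues of unbounded operators -/

section Spectral

variable {E : Type*} [NormedAddCommGroup E] [NormedSpace ℂ E]

/-- The bounded operator `R` is the inverse of `z I - T : D(T) → E`. -/
def IsResolventAt (T : E →ₗ.[ℂ] E) (z : ℂ) (R : E →L[ℂ] E) : Prop :=
  (∀ y : E, ∃ h : R y ∈ T.domain, z • R y - T ⟨R y, h⟩ = y) ∧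
  ∀ x : T.domain, R (z • (x : E) - T x) = x

/-- The resolvent set `ρ(T)`. -/
def opResolventSet (T : E →ₗ.[ℂ] E) : Set ℂ := {z | ∃ R, IsResolventAt T z R}

/-- The spectrum `σ(T)`. -/
def opSpectrum (T : E →ₗ.[ℂ] E) : Set ℂ := (opResolventSet T)ᶜ

open scoped Classical in
/-- The resolvent `z ↦ (z I - T)⁻¹`, with the value `0` on the spectrum. -/
def opResolvent (T : E →ₗ.[ℂ] E) (z : ℂ) : E →L[ℂ] E :=
  if h : ∃ R, IsResolventAt T z R then h.choose else 0

/-- The eigenspace `N(z I - T)`. -/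
def opEigenspace (T : E →ₗ.[ℂ] E) (z : ℂ) : Submodule ℂ E where
  carrier := {x | ∃ h : x ∈ T.domain, T ⟨x, h⟩ = z • x}
  zero_mem' := ⟨T.domain.zero_mem, by
    have h : (⟨0, T.domain.zero_mem⟩ : T.domain) = 0 := rfl
    rw [h, T.map_zero, smul_zero]⟩
  add_mem' := by
    rintro x y ⟨hx, hTx⟩ ⟨hy, hTy⟩
    refine ⟨T.domain.add_mem hx hy, ?_⟩
    have h : (⟨x + y, T.domain.add_mem hx hy⟩ : T.domain) = ⟨x, hx⟩ + ⟨y, hy⟩ := rfl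
    rw [h, T.map_add, hTx, hTy, smul_add]
  smul_mem' := by
    rintro c x ⟨hx, hTx⟩
    refine ⟨T.domain.smul_mem c hx, ?_⟩
    have h : (⟨c • x, T.domain.smul_mem c hx⟩ : T.domain) = c • ⟨x, hx⟩ := rfl
    rw [h, T.map_smul, hTx, smul_comm]

/-- Near `z₀`, except at `z₀`, `f(z) = ∑_{m ≥ -k} (z - z₀)^m B_m`. -/
def HasLaurentExpansion {F : Type*} [NormedAddCommGroup F] [NormedSpace ℂ F]
    (f : ℂ → F) (z₀ : ℂ) (k : ℕ) (B : ℤ → F) : Prop :=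
  ∀ᶠ z in 𝓝[≠] z₀, HasSum (fun m : ℕ => (z - z₀) ^ ((m : ℤ) - k) • B ((m : ℤ) - k)) (f z)

/-- `z₀` is a pole of order `k ≥ 1` of the resolvent of `T`: an isolated point of the spectrum at
which the Laurent expansion of the resolvent starts with the index `-k`. -/
structure IsResolventPole (T : E →ₗ.[ℂ] E) (z₀ : ℂ) (k : ℕ) : Prop where
  one_le : 1 ≤ k
  mem_spectrum : z₀ ∈ opSpectrum T
  isolated : ∀ᶠ z in 𝓝[≠] z₀, z ∈ opResolventSet T
  expansion : ∃ B : ℤ → (E →L[ℂ] E), HasLaurentExpansion (opResolvent T) z₀ k B ∧ B (-k) ≠ 0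

/-- `z₀` is a simple eigenvalue of `T`: a pole of order `1` of the resolvent with a one-dimensional
eigenspace. -/
def IsSimpleEigenvalue (T : E →ₗ.[ℂ] E) (z₀ : ℂ) : Prop :=
  IsResolventPole T z₀ 1 ∧ Module.finrank ℂ (opEigenspace T z₀) = 1

end Spectral

end DelayEquation

end

open DelayEquation

/-! In the half plane `Re z > -η` the spectral theory of `A + L` reduces to the n × n family Δ(z).
The second component of the resolvent equation is ψ' = zψ - φ, so variation of constants gives ψ =
e^{z·}v + ∫_·^0 e^{z(·-s)}φ(s) ds with v = ψ(0). The first component then reads Δ(z)v = α + φ(0) +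
L̂(convolution of φ); this is `resolvent_equation_iff`. Hence the eigenspace is a copy of N(Δ(z)),
and the resolvent is Δ(z)⁻¹ surrounded by holomorphic operator families.

A pole of order one therefore passes from Δ⁻¹ to the resolvent. It also passes back, because Δ(z)⁻¹α
is the value at 0 of the resolvent applied to (α, 0)
(`tendsto_smul_inverse_of_hasLaurentExpansion`). Near every point of the half plane Δ is invertible
off that point (`eventually_isUnit_charOp`), and the condition (z - λ₀)²Δ(z)⁻¹ → 0 makes (z -
λ₀)Δ(z)⁻¹ extend analytically (`exists_analyticAt_of_tendsto_sq_smul`).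

Let D be the limit of (z - λ₀)Δ(z)⁻¹. Then Δ(λ₀)D = DΔ(λ₀) = 0. Passing to the limit in difference
quotients gives MΔ'(λ₀)D = M whenever MΔ(λ₀) = 0, and DΔ'(λ₀)v = v on the kernel of Δ(λ₀)
(`mul_deriv_mul_residue`, `residue_deriv_apply`). Since Δ'(λ₀) is the bracket I + L̂(…), these
relations yield the normalization, the uniqueness of VWᵀ and the projector property. A
one-dimensional kernel forces D to have rank one. -/

noncomputable section

namespace DelayEquation

/-! ### Completeness of `BUC_η`. -/

namespace BUC

variable {η : ℝ} {E : Type*} [NormedAddCommGroup E] [NormedSpace ℝ E]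

@[simp] theorem sub_apply (φ ψ : BUC η E) (θ : Iic (0 : ℝ)) : (φ - ψ) θ = φ θ - ψ θ := rfl

theorem norm_le_of_forall {φ : BUC η E} {C : ℝ}
    (h : ∀ θ : Iic (0 : ℝ), Real.exp (η * θ) * ‖φ θ‖ ≤ C) : ‖φ‖ ≤ C := ciSup_le h

/-- Multiplication with the weight embeds `BUC_η` into the bounded continuous functions. -/
def toBoundedContinuous (φ : BUC η E) : BoundedContinuousFunction (Iic (0 : ℝ)) E :=
  BoundedContinuousFunction.ofNormedAddCommGroup (fun θ : Iic (0 : ℝ) => Real.exp (η * θ) • φ θ)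
    φ.2.2.2.continuous φ.2.2.1.choose φ.2.2.1.choose_spec

theorem toBoundedContinuous_apply (φ : BUC η E) (θ : Iic (0 : ℝ)) :
    toBoundedContinuous φ θ = Real.exp (η * θ) • φ θ := rfl

theorem isometry_toBoundedContinuous :
    Isometry (toBoundedContinuous : BUC η E → BoundedContinuousFunction (Iic (0 : ℝ)) E) := by
  refine Isometry.of_dist_eq fun φ ψ => ?_
  rw [dist_eq_norm, dist_eq_norm]
  have hw : ∀ θ : Iic (0 : ℝ), ‖(toBoundedContinuous φ - toBoundedContinuous ψ) θ‖
      = Real.exp (η * θ) * ‖(φ - ψ) θ‖ := fun θ => by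
    rw [BoundedContinuousFunction.sub_apply, toBoundedContinuous_apply, toBoundedContinuous_apply,
      ← smul_sub, norm_smul, Real.norm_of_nonneg (Real.exp_pos _).le, sub_apply]
  refine le_antisymm ?_ ?_
  · refine (BoundedContinuousFunction.norm_le (norm_nonneg _)).2 fun θ => ?_
    rw [hw]
    exact (φ - ψ).weight_mul_norm_le θ
  · refine norm_le_of_forall fun θ => ?_
    rw [← hw]
    exact BoundedContinuousFunction.norm_coe_le_norm _ θ

/-- Uniform limits of uniformly continuous functions are uniformly continuous, so the image of the
isometric embedding contains its limits. Completeness is needed for the inverses near the identity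
and for analyticity of operator-valued functions. -/
instance [CompleteSpace E] : CompleteSpace (BUC η E) := by
  refine Metric.complete_of_cauchySeq_tendsto fun u hu => ?_
  obtain ⟨g, hg⟩ := cauchySeq_tendsto_of_complete
    (isometry_toBoundedContinuous.uniformContinuous.comp_cauchySeq hu)
  have hgu : UniformContinuous g :=
    (BoundedContinuousFunction.tendsto_iff_tendstoUniformly.1 hg).uniformContinuous
      (Eventually.of_forall fun k => (u k).2.2.2).frequently
  have hcancel : ∀ θ : Iic (0 : ℝ), Real.exp (η * θ) • (Real.exp (-(η * θ)) • g θ) = g θ :=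
    fun θ => by rw [smul_smul, ← Real.exp_add, add_neg_cancel, Real.exp_zero, one_smul]
  let φ : BUC η E := ⟨fun θ => Real.exp (-(η * θ)) • g θ, by
    refine ⟨by fun_prop, ⟨‖g‖, fun θ => ?_⟩, ?_⟩
    · rw [hcancel]
      exact g.norm_coe_le_norm θ
    · simpa only [hcancel] using hgu⟩
  have hφ : toBoundedContinuous φ = g := BoundedContinuousFunction.ext hcancel
  exact ⟨φ, isometry_toBoundedContinuous.isEmbedding.tendsto_nhds_iff.2 (by rwa [hφ])⟩

theorem norm_map_le {F : Type*} [NormedAddCommGroup F] [NormedSpace ℝ F] (T : E →L[ℝ] F)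
    (φ : BUC η E) : ‖φ.map T‖ ≤ ‖T‖ * ‖φ‖ := by
  refine norm_le_of_forall fun θ => ?_
  have h1 := mul_le_mul_of_nonneg_left (T.le_opNorm (φ θ)) (Real.exp_pos (η * θ)).le
  have h2 := mul_le_mul_of_nonneg_left (φ.weight_mul_norm_le θ) (norm_nonneg T)
  rw [map_apply]
  linarith

end BUC

/-! ### The initial value problem ψ' = zψ - φ on the negative half line. -/

section VariationOfConstants

variable {η : ℝ} {n : ℕ} {z : ℂ}

theorem hasDeriv_of_hasDerivAt {φ ψ : BUC η (Fin n → ℂ)} {f f' : ℝ → Fin n → ℂ}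
    (hf : ∀ θ : Iic (0 : ℝ), φ θ = f θ) (hf' : ∀ θ : Iic (0 : ℝ), ψ θ = f' θ)
    (hd : ∀ θ, HasDerivAt f (f' θ) θ) : HasDeriv φ ψ := by
  intro θ
  rw [hf']
  refine (hd θ).hasDerivWithinAt.congr (fun s hs => ?_) ?_
  · rw [IicExtend_of_mem _ hs, hf]
  · rw [IicExtend_of_mem _ θ.2, hf]

theorem hasDeriv_expFun (hz : -η < z.re) (x : Fin n → ℂ) :
    HasDeriv (expFun hz x) (z • expFun hz x) :=
  hasDeriv_of_hasDerivAt (f := fun θ : ℝ => Complex.exp (z * θ) • x)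
    (f' := fun θ : ℝ => (z * Complex.exp (z * θ)) • x) (fun _ => rfl)
    (fun θ => smul_smul z (Complex.exp (z * (θ : ℝ))) x)
    fun θ => (hasDerivAt_cexp_mul z θ).smul_const x

theorem hasDeriv_convFun (hz : -η < z.re) (φ : BUC η (Fin n → ℂ)) :
    HasDeriv (convFun hz φ) (z • convFun hz φ - φ) := by
  refine hasDeriv_of_hasDerivAt (f := convValue z φ) (fun _ => rfl) (fun θ => ?_)
    (hasDerivAt_convValue z φ)
  rw [IicExtend_of_mem _ θ.2]
  rfl

theorem HasDeriv.sub {φ ψ φ' ψ' : BUC η (Fin n → ℂ)} (h : HasDeriv φ ψ) (k : HasDeriv φ' ψ') :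
    HasDeriv (φ - φ') (ψ - ψ') := fun θ => (h θ).sub (k θ)

@[simp] theorem expFun_zeroPt (hz : -η < z.re) (x : Fin n → ℂ) : expFun hz x zeroPt = x := by
  change Complex.exp (z * ((0 : ℝ) : ℂ)) • x = x
  simp

@[simp] theorem convFun_zeroPt (hz : -η < z.re) (φ : BUC η (Fin n → ℂ)) :
    convFun hz φ zeroPt = 0 := intervalIntegral.integral_same

/-- The product e^{-zθ}χ(θ) has derivative zero, hence is constant and equal to its value at 0. -/
theorem HasDeriv.eq_zero {χ : BUC η (Fin n → ℂ)} (h : HasDeriv χ (z • χ)) (h0 : χ zeroPt = 0) :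
    χ = 0 := by
  have hg : ∀ θ ∈ Iic (0 : ℝ), HasDerivWithinAt
      (fun s : ℝ => Complex.exp (-z * s) • IicExtend χ s) 0 (Iic 0) θ := by
    intro θ hθ
    refine ((hasDerivAt_cexp_mul (-z) θ).hasDerivWithinAt.smul (h ⟨θ, hθ⟩)).congr_deriv ?_
    rw [IicExtend_of_mem _ hθ, BUC.smul_apply, smul_smul, ← add_smul]
    ring_nf
    simp
  ext1 θ
  have key := (convex_Iic (0 : ℝ)).norm_image_sub_le_of_norm_hasDerivWithin_le hg
    (C := 0) (fun _ _ => by simp) (mem_Iic.2 le_rfl) θ.2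
  have h0' : IicExtend χ (0 : ℝ) = 0 := (IicExtend_of_mem _ (mem_Iic.2 le_rfl)).trans h0
  rw [h0', smul_zero, sub_zero, zero_mul, norm_le_zero_iff, IicExtend_of_mem _ θ.2] at key
  exact (smul_eq_zero.1 key).resolve_left (Complex.exp_ne_zero _)

/-- Uniqueness for the initial value problem. It replaces manipulations of integrals: linearity of
the convolution and the resolvent identities below are all checked by comparing derivatives and
values at 0. -/
theorem HasDeriv.ext {φ ψ χ : BUC η (Fin n → ℂ)} (h : HasDeriv φ (z • φ - χ))
    (k : HasDeriv ψ (z • ψ - χ)) (h0 : φ zeroPt = ψ zeroPt) : φ = ψ := by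
  refine sub_eq_zero.1 (HasDeriv.eq_zero (z := z) ?_ (sub_eq_zero.2 h0))
  have := h.sub k
  rwa [sub_sub_sub_cancel_right, ← smul_sub] at this

theorem hasDeriv_expFun_add_convFun (hz : -η < z.re) (x : Fin n → ℂ) (φ : BUC η (Fin n → ℂ)) :
    HasDeriv (expFun hz x + convFun hz φ) (z • (expFun hz x + convFun hz φ) - φ) := by
  have := (hasDeriv_expFun hz x).add (hasDeriv_convFun hz φ)
  rwa [← add_sub_assoc, ← smul_add] at this

/-- The variation of constants formula. -/
theorem HasDeriv.eq_expFun_add_convFun (hz : -η < z.re) {ψ φ : BUC η (Fin n → ℂ)}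
    (h : HasDeriv ψ (z • ψ - φ)) : ψ = expFun hz (ψ zeroPt) + convFun hz φ :=
  h.ext (hasDeriv_expFun_add_convFun hz _ φ) (by simp)

theorem HasDeriv.eq_convFun (hz : -η < z.re) {ψ φ : BUC η (Fin n → ℂ)}
    (h : HasDeriv ψ (z • ψ - φ)) (h0 : ψ zeroPt = 0) : ψ = convFun hz φ :=
  h.ext (hasDeriv_convFun hz φ) (by simpa using h0)

end VariationOfConstants

/-! ### Exponentials and convolutions as holomorphic families of bounded operators. -/

section BoundedOperators

variable (η : ℝ) (n : ℕ)

/-- Evaluation at `0`. -/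
def evalZero : BUC η (Fin n → ℂ) →L[ℂ] (Fin n → ℂ) :=
  LinearMap.mkContinuous
    { toFun := fun φ => φ zeroPt
      map_add' := fun _ _ => rfl
      map_smul' := fun _ _ => rfl } 1 fun φ => by
    have h := φ.weight_mul_norm_le zeroPt
    simpa [zeroPt] using h

@[simp] theorem evalZero_apply (φ : BUC η (Fin n → ℂ)) : evalZero η n φ = φ zeroPt := rfl

open scoped Classical in
/-- The bounded operator `x ↦ e^{z·} x` for `Re z > -η`, and `0` otherwise. -/
def expL (z : ℂ) : (Fin n → ℂ) →L[ℂ] BUC η (Fin n → ℂ) :=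
  if hz : -η < z.re then
    LinearMap.toContinuousLinearMap
      { toFun := expFun hz
        map_add' := fun x y => BUC.ext fun _ => smul_add _ x y
        map_smul' := fun c x => BUC.ext fun _ => smul_comm _ c x }
  else 0

open scoped Classical in
/-- The bounded operator `φ ↦ ∫_·^0 e^{z(· - s)} φ(s) ds` for `Re z > -η`, and `0` otherwise. -/
def convL (z : ℂ) : BUC η (Fin n → ℂ) →L[ℂ] BUC η (Fin n → ℂ) :=
  if hz : -η < z.re then
    LinearMap.mkContinuous
      { toFun := convFun hz
        map_add' := fun φ ψ => by
          refine (HasDeriv.eq_convFun hz ?_ (by simp)).symm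
          have := (hasDeriv_convFun hz φ).add (hasDeriv_convFun hz ψ)
          rwa [sub_add_sub_comm, ← smul_add] at this
        map_smul' := fun c φ => by
          refine (HasDeriv.eq_convFun hz ?_ (by simp)).symm
          have := (hasDeriv_convFun hz φ).smul c
          rwa [smul_sub, smul_comm] at this } (1 / (z.re + η)) fun φ =>
      BUC.norm_le_of_forall fun θ => by
        refine (weight_mul_norm_convValue hz φ θ.2).trans_eq ?_
        ring
  else 0

variable {η n}

theorem expL_apply {z : ℂ} (hz : -η < z.re) (x : Fin n → ℂ) : expL η n z x = expFun hz x := by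
  rw [expL, dif_pos hz]
  rfl

theorem convL_apply {z : ℂ} (hz : -η < z.re) (φ : BUC η (Fin n → ℂ)) :
    convL η n z φ = convFun hz φ := by
  rw [convL, dif_pos hz]
  rfl

/-- The difference χ of the two exponentials vanishes at 0 and solves χ' = wχ - (w - z)e^{z·}x, so
it is a convolution with parameter w. -/
theorem expL_sub_expL {z w : ℂ} (hz : -η < z.re) (hw : -η < w.re) :
    expL η n z - expL η n w = (w - z) • (convL η n w).comp (expL η n z) := by
  ext1 x
  simp only [sub_apply, smul_apply,
    ContinuousLinearMap.comp_apply]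
  rw [← map_smul, expL_apply hz, expL_apply hw, convL_apply hw]
  refine HasDeriv.eq_convFun hw ?_ (by simp)
  convert (hasDeriv_expFun hz x).sub (hasDeriv_expFun hw x) using 1
  module

/-- The same comparison for convolutions: the inhomogeneities φ cancel and only (w - z) times the
convolution with parameter z remains. -/
theorem convL_sub_convL {z w : ℂ} (hz : -η < z.re) (hw : -η < w.re) :
    convL η n z - convL η n w = (w - z) • (convL η n w).comp (convL η n z) := by
  ext1 φ
  simp only [sub_apply, smul_apply,
    ContinuousLinearMap.comp_apply]
  rw [← map_smul, convL_apply hz, convL_apply hw, convL_apply hw]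
  refine HasDeriv.eq_convFun hw ?_ (by simp)
  convert (hasDeriv_convFun hz φ).sub (hasDeriv_convFun hw φ) using 1
  module

theorem isOpen_halfPlane (η : ℝ) : IsOpen {z : ℂ | -η < z.re} :=
  isOpen_lt continuous_const Complex.continuous_re

theorem eventually_mem_halfPlane {w : ℂ} (hw : -η < w.re) : ∀ᶠ z in 𝓝 w, -η < z.re :=
  (isOpen_halfPlane η).mem_nhds hw

/-- A family of operators that satisfies a resolvent identity is differentiable. -/
theorem hasDerivAt_of_resolvent_identity {X Y : Type*} [NormedAddCommGroup X] [NormedSpace ℂ X]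
    [NormedAddCommGroup Y] [NormedSpace ℂ Y] [CompleteSpace Y] {F : ℂ → X →L[ℂ] Y}
    {K : Y →L[ℂ] Y} {w : ℂ} (h : ∀ᶠ z in 𝓝 w, F z - F w = (w - z) • K.comp (F z)) :
    HasDerivAt F (-(K.comp (F w))) w := by
  -- The identity rearranges to F w = (1 + (z - w)K) F z. Inverting the factor, which is close to 1,
  -- gives continuity of F at w; then the slope, which equals -K F z, converges.
  have hu : ContinuousAt (fun z : ℂ => (1 : Y →L[ℂ] Y) + (z - w) • K) w := by fun_prop
  have h1 : (1 : Y →L[ℂ] Y) + (w - w) • K = (1 : (Y →L[ℂ] Y)ˣ) := by simp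
  have hinv : ContinuousAt (fun z : ℂ => Ring.inverse ((1 : Y →L[ℂ] Y) + (z - w) • K)) w := by
    refine ContinuousAt.comp (g := Ring.inverse) ?_ hu
    rw [h1]
    exact NormedRing.inverse_continuousAt 1
  have hunit : ∀ᶠ z in 𝓝 w, IsUnit ((1 : Y →L[ℂ] Y) + (z - w) • K) := by
    refine hu.eventually (p := IsUnit) ?_
    beta_reduce
    rw [h1]
    exact Units.isOpen.mem_nhds isUnit_one
  have heq : F =ᶠ[𝓝 w]
      fun z => (Ring.inverse ((1 : Y →L[ℂ] Y) + (z - w) • K)).comp (F w) := by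
    filter_upwards [h, hunit] with z hz hzu
    have h2 : F w = ((1 : Y →L[ℂ] Y) + (z - w) • K).comp (F z) := by
      rw [ContinuousLinearMap.add_comp, ContinuousLinearMap.smul_comp,
        ← sub_eq_zero]
      have h3 : ((1 : Y →L[ℂ] Y)).comp (F z) = F z := ContinuousLinearMap.id_comp _
      rw [h3, ← neg_eq_zero, neg_sub, add_sub_right_comm, hz]
      module
    rw [h2, ← ContinuousLinearMap.comp_assoc]
    change _ = (Ring.inverse _ * _ : Y →L[ℂ] Y).comp (F z)
    rw [Ring.inverse_mul_cancel _ hzu]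
    exact (ContinuousLinearMap.id_comp _).symm
  have hF : ContinuousAt F w := by
    refine ContinuousAt.congr ?_ heq.symm
    exact hinv.clm_comp continuousAt_const
  rw [hasDerivAt_iff_tendsto_slope]
  have hlim : Tendsto (fun z => -(K.comp (F z))) (𝓝[≠] w) (𝓝 (-(K.comp (F w)))) :=
    ((continuousAt_const.clm_comp hF).neg.tendsto).mono_left nhdsWithin_le_nhds
  refine hlim.congr' ?_
  filter_upwards [h.filter_mono nhdsWithin_le_nhds, self_mem_nhdsWithin] with z hz hne
  have hne' : z - w ≠ 0 := sub_ne_zero.2 hne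
  rw [slope_def_module, hz, smul_smul, ← neg_sub z w, mul_neg, inv_mul_cancel₀ hne', neg_one_smul]

theorem hasDerivAt_expL {w : ℂ} (hw : -η < w.re) :
    HasDerivAt (expL η n) (-((convL η n w).comp (expL η n w))) w :=
  hasDerivAt_of_resolvent_identity
    ((eventually_mem_halfPlane hw).mono fun _ hz => expL_sub_expL hz hw)

theorem hasDerivAt_convL {w : ℂ} (hw : -η < w.re) :
    HasDerivAt (convL η n) (-((convL η n w).comp (convL η n w))) w :=
  hasDerivAt_of_resolvent_identity
    ((eventually_mem_halfPlane hw).mono fun _ hz => convL_sub_convL hz hw)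

/-- The bound does not depend on z, which is what makes z dominate in Δ(z) for large |z|. -/
theorem norm_expL_apply_le (z : ℂ) (x : Fin n → ℂ) : ‖expL η n z x‖ ≤ ‖x‖ := by
  by_cases hz : -η < z.re
  · rw [expL_apply hz]
    refine BUC.norm_le_of_forall fun θ => ?_
    change Real.exp (η * θ) * ‖Complex.exp (z * (θ : ℝ)) • x‖ ≤ ‖x‖
    have h := weight_mul_norm_cexp (η := η) z θ 0
    simp only [Complex.ofReal_zero, sub_zero, mul_zero, Real.exp_zero, mul_one] at h
    rw [norm_smul, ← mul_assoc, h]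
    refine mul_le_of_le_one_left (norm_nonneg _) (Real.exp_le_one_iff.2 ?_)
    exact mul_nonpos_of_nonneg_of_nonpos (by linarith) θ.2
  · simp [expL, hz]

end BoundedOperators

/-! ### The characteristic matrix: derivative, invertibility, and passage between matrices and
operators. -/

section CharacteristicOperator

variable {η : ℝ} {n : ℕ} (Lhat : BUC η (Fin n → ℝ) →L[ℝ] (Fin n → ℝ))

/-- The complex linear extension of `Lhat` as a bounded operator. -/
def complexifyL : BUC η (Fin n → ℂ) →L[ℂ] (Fin n → ℂ) :=
  (complexify Lhat).mkContinuous (‖Lhat‖ * ‖reMap n‖ + ‖Lhat‖ * ‖imMap n‖) fun φ => by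
    refine (pi_norm_le_iff_of_nonneg (by positivity)).2 fun j => ?_
    have hT : ∀ T : (Fin n → ℂ) →L[ℝ] (Fin n → ℝ),
        |Lhat (φ.map T) j| ≤ ‖Lhat‖ * ‖T‖ * ‖φ‖ := fun T =>
      calc |Lhat (φ.map T) j| ≤ ‖Lhat (φ.map T)‖ := norm_le_pi_norm (Lhat (φ.map T)) j
        _ ≤ ‖Lhat‖ * ‖φ.map T‖ := Lhat.le_opNorm _
        _ ≤ ‖Lhat‖ * (‖T‖ * ‖φ‖) :=
          mul_le_mul_of_nonneg_left (BUC.norm_map_le T φ) (norm_nonneg _)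
        _ = ‖Lhat‖ * ‖T‖ * ‖φ‖ := (mul_assoc _ _ _).symm
    rw [add_mul]
    refine (norm_add_le _ _).trans (add_le_add ?_ ?_)
    · simpa using hT (reMap n)
    · simpa using hT (imMap n)

@[simp] theorem complexifyL_apply (φ : BUC η (Fin n → ℂ)) :
    complexifyL Lhat φ = complexify Lhat φ := rfl

/-- The operator of multiplication with the characteristic matrix. -/
def charOp (z : ℂ) : (Fin n → ℂ) →L[ℂ] (Fin n → ℂ) :=
  z • (1 : (Fin n → ℂ) →L[ℂ] (Fin n → ℂ)) - (complexifyL Lhat).comp (expL η n z)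

/-- The derivative of the characteristic operator. -/
def charOpDeriv (z : ℂ) : (Fin n → ℂ) →L[ℂ] (Fin n → ℂ) :=
  1 + (complexifyL Lhat).comp ((convL η n z).comp (expL η n z))

variable {Lhat} {z w : ℂ}

theorem charOp_apply (hz : -η < z.re) (v : Fin n → ℂ) :
    charOp Lhat z v = z • v - complexify Lhat (expFun hz v) := by
  simp [charOp, expL_apply hz]

/-- The exponential family has derivative minus convolution after exponential, so the two minus
signs cancel. -/
theorem hasDerivAt_charOp (hz : -η < z.re) :
    HasDerivAt (charOp Lhat) (charOpDeriv Lhat z) z := by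
  have h1 : HasDerivAt (fun w : ℂ => w • (1 : (Fin n → ℂ) →L[ℂ] (Fin n → ℂ))) 1 z := by
    simpa using (hasDerivAt_id z).smul_const (1 : (Fin n → ℂ) →L[ℂ] (Fin n → ℂ))
  have h2 := (hasDerivAt_const z (complexifyL Lhat)).clm_comp (hasDerivAt_expL (n := n) hz)
  refine (h1.sub h2).congr_deriv ?_
  rw [ContinuousLinearMap.zero_comp, zero_add, ContinuousLinearMap.comp_neg, sub_neg_eq_add]
  rfl

theorem hatMatrix_mulVec {k : (Fin n → ℂ) → BUC η (Fin n → ℂ)}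
    (K : (Fin n → ℂ) →L[ℂ] BUC η (Fin n → ℂ)) (hK : ∀ x, K x = k x) (v : Fin n → ℂ) :
    (hatMatrix Lhat k).mulVec v = complexify Lhat (k v) := by
  have h : hatMatrix Lhat k
      = LinearMap.toMatrix' ((complexifyL Lhat).comp K).toLinearMap := by
    ext i j
    rw [LinearMap.toMatrix'_apply]
    change complexify Lhat (k _) i = complexify Lhat (K _) i
    rw [hK]
  rw [h, LinearMap.toMatrix'_mulVec]
  change complexify Lhat (K v) = _
  rw [hK]

theorem charMatrix_mulVec (hz : -η < z.re) (v : Fin n → ℂ) :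
    (charMatrix Lhat z).mulVec v = charOp Lhat z v := by
  rw [charMatrix, dif_pos hz, Matrix.sub_mulVec, Matrix.smul_mulVec, Matrix.one_mulVec,
    hatMatrix_mulVec (expL η n z) (expL_apply hz), charOp_apply hz]

/-- Since e^{z(θ-s)}e^{zs} = e^{zθ}, the integrand of the convolution does not depend on s. Through
this the bracket of the theorem becomes Δ'(z). -/
theorem tailFun_eq_convFun (hz : -η < z.re) (x : Fin n → ℂ) :
    tailFun hz x = convFun hz (expFun hz x) := by
  ext1 θ
  change (∫ _s in (θ : ℝ)..0, Complex.exp (z * (θ : ℝ))) • x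
    = ∫ s in (θ : ℝ)..0, Complex.exp (z * ((θ : ℝ) - s)) • IicExtend (expFun hz x) s
  rw [← intervalIntegral.integral_smul_const]
  refine intervalIntegral.integral_congr fun s hs => ?_
  rw [uIcc_of_le θ.2] at hs
  have hs0 : s ∈ Iic (0 : ℝ) := hs.2
  simp only [IicExtend_of_mem _ hs0]
  change _ = Complex.exp (z * ((θ : ℝ) - s)) • (Complex.exp (z * s) • x)
  rw [smul_smul, ← Complex.exp_add]
  congr 2
  ring

theorem one_add_hatMatrix_tailFun_mulVec (hz : -η < z.re) (v : Fin n → ℂ) :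
    (1 + hatMatrix Lhat (tailFun hz)).mulVec v = charOpDeriv Lhat z v := by
  rw [Matrix.add_mulVec, Matrix.one_mulVec,
    hatMatrix_mulVec ((convL η n z).comp (expL η n z)) fun x => by
      rw [ContinuousLinearMap.comp_apply, expL_apply hz, convL_apply hz, tailFun_eq_convFun]]
  rw [tailFun_eq_convFun, ← convL_apply hz, ← expL_apply hz]
  rfl

/-- The bounded operator given by a square matrix. -/
def mulVecL : Matrix (Fin n) (Fin n) ℂ ≃ₐ[ℂ] ((Fin n → ℂ) →L[ℂ] (Fin n → ℂ)) :=
  Matrix.toLinAlgEquiv'.trans (Module.End.toContinuousLinearMap (Fin n → ℂ))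

@[simp] theorem mulVecL_apply (M : Matrix (Fin n) (Fin n) ℂ) (v : Fin n → ℂ) :
    mulVecL M v = M.mulVec v := rfl

theorem mulVecL_charMatrix (hz : -η < z.re) : mulVecL (charMatrix Lhat z) = charOp Lhat z := by
  ext1 v
  exact charMatrix_mulVec hz v

/-- An algebra isomorphism respects inverses of units, and on non-units both conventions give 0, so
no invertibility is assumed. -/
theorem mulVecL_inv (M : Matrix (Fin n) (Fin n) ℂ) : mulVecL M⁻¹ = Ring.inverse (mulVecL M) := by
  rw [Matrix.nonsing_inv_eq_ringInverse]
  by_cases hM : IsUnit M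
  · have h := hM.map mulVecL
    rw [← mul_one (Ring.inverse (mulVecL M)), ← map_one (mulVecL (n := n)),
      ← Ring.mul_inverse_cancel M hM, map_mul, ← mul_assoc, Ring.inverse_mul_cancel _ h, one_mul]
  · have h : ¬ IsUnit (mulVecL M) := fun h => hM (by
      have := h.map (mulVecL (n := n)).symm
      rwa [AlgEquiv.symm_apply_apply] at this)
    rw [Ring.inverse_non_unit _ hM, Ring.inverse_non_unit _ h, map_zero]

theorem continuous_mulVecL : Continuous (mulVecL (n := n)) :=
  LinearMap.continuous_of_finiteDimensional (mulVecL (n := n)).toLinearMap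

theorem continuous_mulVecL_symm : Continuous (mulVecL (n := n)).symm :=
  LinearMap.continuous_of_finiteDimensional (mulVecL (n := n)).symm.toLinearMap

theorem tendsto_mulVecL_iff {ι : Type*} {l : Filter ι} {f : ι → Matrix (Fin n) (Fin n) ℂ}
    {M : Matrix (Fin n) (Fin n) ℂ} :
    Tendsto (fun i => mulVecL (f i)) l (𝓝 (mulVecL M)) ↔ Tendsto f l (𝓝 M) := by
  refine ⟨fun h => ?_, fun h => (continuous_mulVecL.tendsto M).comp h⟩
  have := (continuous_mulVecL_symm.tendsto (mulVecL M)).comp h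
  simpa only [Function.comp_def, AlgEquiv.symm_apply_apply] using this

/-- A kernel vector satisfies zv = L̂(e^{z·}v), hence |z|‖v‖ ≤ ‖L̂‖‖v‖. -/
theorem charOp_injective_of_large (hz : -η < z.re) (h : ‖complexifyL Lhat‖ < ‖z‖) :
    Function.Injective (charOp Lhat z) := by
  refine (injective_iff_map_eq_zero _).2 fun v hv => ?_
  have h1 : z • v = complexifyL Lhat (expL η n z v) := by
    rw [charOp_apply hz, sub_eq_zero] at hv
    rw [hv, expL_apply hz, complexifyL_apply]
  have h2 : ‖z‖ * ‖v‖ ≤ ‖complexifyL Lhat‖ * ‖v‖ := by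
    rw [← norm_smul, h1]
    exact ((complexifyL Lhat).le_opNorm _).trans
      (mul_le_mul_of_nonneg_left (norm_expL_apply_le z v) (norm_nonneg _))
  by_contra hne
  exact absurd (le_of_mul_le_mul_right h2 (norm_pos_iff.2 hne)) (not_le.2 h)

theorem isUnit_charOp_iff_isUnit_det (hz : -η < z.re) :
    IsUnit (charOp Lhat z) ↔ (charMatrix Lhat z).det ≠ 0 := by
  rw [← mulVecL_charMatrix hz, MulEquiv.isUnit_map, Matrix.isUnit_iff_isUnit_det, isUnit_iff_ne_zero]

theorem isUnit_charOp_iff_injective (hz : -η < z.re) :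
    IsUnit (charOp Lhat z) ↔ Function.Injective (charOp Lhat z) := by
  rw [← mulVecL_charMatrix hz, MulEquiv.isUnit_map, ← Matrix.mulVec_injective_iff_isUnit]
  rfl

variable (Lhat) in
theorem differentiableOn_det_charMatrix :
    DifferentiableOn ℂ (fun z => (charMatrix Lhat z).det) {z | -η < z.re} := by
  intro z hz
  refine DifferentiableAt.differentiableWithinAt ?_
  have hentry : ∀ i j, DifferentiableAt ℂ (fun z => charMatrix Lhat z i j) z := by
    intro i j
    have h1 : DifferentiableAt ℂ (fun z => charOp Lhat z (Pi.single j 1) i) z :=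
      differentiableAt_pi.1
        ((hasDerivAt_charOp hz).differentiableAt.clm_apply (differentiableAt_const _)) i
    refine h1.congr_of_eventuallyEq ?_
    filter_upwards [eventually_mem_halfPlane hz] with w hw
    rw [← charMatrix_mulVec hw, Matrix.mulVec_single_one]
    rfl
  simp only [Matrix.det_apply]
  fun_prop

/-- The determinant is holomorphic on the connected half plane and nonzero at large real points, so
by the identity theorem its zeros are isolated. -/
theorem eventually_isUnit_charOp (hz : -η < z.re) :
    ∀ᶠ w in 𝓝[≠] z, IsUnit (charOp Lhat w) := by
  have hU := isOpen_halfPlane η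
  have han := (differentiableOn_det_charMatrix Lhat).analyticOnNhd hU
  have hconn : IsPreconnected {z : ℂ | -η < z.re} := (convex_halfSpace_re_gt (-η)).isPreconnected
  have hne : ∀ᶠ w in 𝓝[≠] z, (charMatrix Lhat w).det ≠ 0 := by
    rcases (han z hz).eventually_eq_zero_or_eventually_ne_zero with h0 | h0
    · exfalso
      have hzero := han.eqOn_zero_of_preconnected_of_eventuallyEq_zero hconn hz h0
      obtain ⟨r, hr1, hr2⟩ : ∃ r : ℝ, -η < r ∧ ‖complexifyL Lhat‖ < r :=
        ⟨max (-η) ‖complexifyL Lhat‖ + 1, by linarith [le_max_left (-η) ‖complexifyL Lhat‖],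
          by linarith [le_max_right (-η) ‖complexifyL Lhat‖]⟩
      have hr : -η < (r : ℂ).re := by simpa using hr1
      have hinj := charOp_injective_of_large (Lhat := Lhat) hr
        (hr2.trans_le (by simpa using le_abs_self r))
      exact (isUnit_charOp_iff_isUnit_det hr).1 ((isUnit_charOp_iff_injective hr).2 hinj)
        (hzero hr)
    · exact h0
  filter_upwards [hne, (eventually_mem_halfPlane hz).filter_mono nhdsWithin_le_nhds] with w h1 h2
  exact (isUnit_charOp_iff_isUnit_det h2).2 h1

end CharacteristicOperator

/-! ### The resolvent equation and the eigenspace. -/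

section Resolvent

variable {η : ℝ} {n : ℕ} {Lhat : BUC η (Fin n → ℝ) →L[ℝ] (Fin n → ℝ)} {z : ℂ}

theorem mem_opAL_domain {x : StateSpace η n} :
    x ∈ (opAL Lhat).domain ↔ x.1 = 0 ∧ ∃ ψ, HasDeriv x.2 ψ := by
  rw [opAL_domain]
  rfl

theorem opAL_apply (x : (opAL Lhat).domain) {ψ : BUC η (Fin n → ℂ)} (h : HasDeriv x.1.2 ψ) :
    opAL Lhat x = (-(ψ zeroPt) + complexify Lhat x.1.2, ψ) := by
  have hA := opA_apply ⟨x.1, (opAL_domain Lhat).le x.2⟩ h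
  change opA η n ⟨x.1, _⟩ + (complexify Lhat x.1.2, 0) = _
  rw [hA, Prod.mk_add_mk, add_zero]

variable (Lhat z) in
/-- The functional whose value is the right-hand side of the characteristic equation. -/
def charRhs : StateSpace η n →L[ℂ] (Fin n → ℂ) :=
  ContinuousLinearMap.fst ℂ _ _ +
    (evalZero η n + (complexifyL Lhat).comp (convL η n z)).comp (ContinuousLinearMap.snd ℂ _ _)

theorem charRhs_apply (hz : -η < z.re) (y : StateSpace η n) :
    charRhs Lhat z y = y.1 + y.2 zeroPt + complexify Lhat (convFun hz y.2) := by
  change y.1 + (y.2 zeroPt + complexify Lhat (convL η n z y.2)) = _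
  rw [convL_apply hz, add_assoc]

/-- The solutions of the resolvent equation `(z - (A + L)) x = y`. -/
theorem resolvent_equation_iff (hz : -η < z.re) (x y : StateSpace η n) :
    (∃ h : x ∈ (opAL Lhat).domain, z • x - opAL Lhat ⟨x, h⟩ = y) ↔
      ∃ v, charOp Lhat z v = charRhs Lhat z y ∧ x = (0, expFun hz v + convFun hz y.2) := by
  rw [charRhs_apply hz]
  constructor
  · rintro ⟨h, hy⟩
    obtain ⟨h1, ψ, hψ⟩ := mem_opAL_domain.1 h
    rw [opAL_apply ⟨x, h⟩ hψ] at hy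
    obtain ⟨α, φ⟩ := y
    obtain ⟨a, χ⟩ := x
    obtain ⟨hα, hφ⟩ := Prod.mk.inj hy
    dsimp only at h1 hψ hα hφ ⊢
    subst h1
    change z • (0 : Fin n → ℂ) - _ = α at hα
    change z • χ - ψ = φ at hφ
    have hψ' : ψ = z • χ - φ := by rw [← hφ, sub_sub_cancel]
    rw [hψ'] at hψ hα
    -- The second component determines χ from v = χ(0); inserting this form into the first component
    -- produces the characteristic equation for v.
    have hχ := hψ.eq_expFun_add_convFun hz
    refine ⟨χ zeroPt, ?_, by rw [← hχ]⟩
    have hL : complexify Lhat χ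
        = complexify Lhat (expFun hz (χ zeroPt)) + complexify Lhat (convFun hz φ) := by
      rw [← map_add, ← hχ]
    rw [charOp_apply hz, ← hα, hL, BUC.sub_apply, BUC.smul_apply, smul_zero]
    abel
  · rintro ⟨v, hv, rfl⟩
    have hd := hasDeriv_expFun_add_convFun hz v y.2
    refine ⟨mem_opAL_domain.2 ⟨rfl, _, hd⟩, ?_⟩
    rw [opAL_apply _ hd]
    refine Prod.ext ?_ (sub_sub_cancel _ _)
    change z • (0 : Fin n → ℂ) - (-((z • (expFun hz v + convFun hz y.2) - y.2) zeroPt)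
      + complexify Lhat (expFun hz v + convFun hz y.2)) = y.1
    rw [charOp_apply hz, sub_eq_iff_eq_add] at hv
    rw [BUC.sub_apply, BUC.smul_apply, BUC.add_apply, expFun_zeroPt, convFun_zeroPt, add_zero, hv,
      map_add, smul_zero]
    abel

variable (Lhat z) in
/-- The solution operator of the resolvent equation, where `T` stands for the inverse of the
characteristic operator. -/
def solOp (T : (Fin n → ℂ) →L[ℂ] (Fin n → ℂ)) (c : ℂ) : StateSpace η n →L[ℂ] StateSpace η n :=
  (ContinuousLinearMap.inr ℂ (Fin n → ℂ) (BUC η (Fin n → ℂ))).comp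
    ((expL η n z).comp (T.comp (charRhs Lhat z)) +
      c • (convL η n z).comp (ContinuousLinearMap.snd ℂ _ _))

theorem solOp_apply (hz : -η < z.re) (T : (Fin n → ℂ) →L[ℂ] (Fin n → ℂ)) (c : ℂ)
    (y : StateSpace η n) :
    solOp Lhat z T c y = (0, expFun hz (T (charRhs Lhat z y)) + c • convFun hz y.2) := by
  rw [← expL_apply hz, ← convL_apply hz]
  rfl

/-- The parameter c lets a factor z - λ₀ be absorbed: multiplying the resolvent by it puts (z -
λ₀)Δ(z)⁻¹ in place of T and z - λ₀ in place of c, and both can extend analytically to λ₀. -/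
theorem smul_solOp (T : (Fin n → ℂ) →L[ℂ] (Fin n → ℂ)) (b c : ℂ) :
    b • solOp Lhat z T c = solOp Lhat z (b • T) (b * c) := by
  simp only [solOp, ContinuousLinearMap.smul_comp, ContinuousLinearMap.comp_smul,
    ContinuousLinearMap.comp_add, smul_add, smul_smul]

theorem isResolventAt_solOp (hz : -η < z.re) (h : IsUnit (charOp Lhat z)) :
    IsResolventAt (opAL Lhat) z (solOp Lhat z (Ring.inverse (charOp Lhat z)) 1) := by
  have hl : ∀ v, charOp Lhat z (Ring.inverse (charOp Lhat z) v) = v := fun v =>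
    congrArg (fun T : (Fin n → ℂ) →L[ℂ] (Fin n → ℂ) => T v) (Ring.mul_inverse_cancel _ h)
  have hr : ∀ v, Ring.inverse (charOp Lhat z) (charOp Lhat z v) = v := fun v =>
    congrArg (fun T : (Fin n → ℂ) →L[ℂ] (Fin n → ℂ) => T v) (Ring.inverse_mul_cancel _ h)
  constructor
  · intro y
    refine (resolvent_equation_iff hz _ y).2 ⟨_, hl (charRhs Lhat z y), ?_⟩
    rw [solOp_apply hz, one_smul]
  · intro x
    obtain ⟨v, hv, hx⟩ := (resolvent_equation_iff (Lhat := Lhat) hz x.1 _).1 ⟨x.2, rfl⟩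
    rw [solOp_apply hz, one_smul, ← hv, hr]
    exact hx.symm

theorem IsResolventAt.unique {E : Type*} [NormedAddCommGroup E] [NormedSpace ℂ E]
    {T : E →ₗ.[ℂ] E} {R R' : E →L[ℂ] E} (h : IsResolventAt T z R) (h' : IsResolventAt T z R') :
    R = R' := by
  ext1 y
  obtain ⟨hy, hy'⟩ := h.1 y
  have := h'.2 ⟨R y, hy⟩
  rw [hy'] at this
  exact this.symm

theorem opResolvent_eq {E : Type*} [NormedAddCommGroup E] [NormedSpace ℂ E]
    {T : E →ₗ.[ℂ] E} {R : E →L[ℂ] E} (h : IsResolventAt T z R) : opResolvent T z = R := by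
  have hex : ∃ R, IsResolventAt T z R := ⟨R, h⟩
  rw [opResolvent, dif_pos hex]
  exact hex.choose_spec.unique h

theorem mem_opEigenspace_iff (hz : -η < z.re) (x : StateSpace η n) :
    x ∈ opEigenspace (opAL Lhat) z ↔ ∃ v, charOp Lhat z v = 0 ∧ x = (0, expFun hz v) := by
  have h := resolvent_equation_iff (Lhat := Lhat) hz x 0
  rw [map_zero, Prod.snd_zero, ← convL_apply hz, map_zero] at h
  simp only [add_zero] at h
  rw [← h]
  simp only [sub_eq_zero]
  exact exists_congr fun _ => eq_comm

theorem opEigenspace_eq_map (hz : -η < z.re) :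
    opEigenspace (opAL Lhat) z = (LinearMap.ker (charMatrix Lhat z).mulVecLin).map
      ((LinearMap.inr ℂ (Fin n → ℂ) (BUC η (Fin n → ℂ))).comp (expL η n z).toLinearMap) := by
  ext x
  rw [mem_opEigenspace_iff hz, Submodule.mem_map]
  refine exists_congr fun v => and_congr ?_ ?_
  · rw [LinearMap.mem_ker, Matrix.mulVecLin_apply, charMatrix_mulVec hz]
  · rw [← expL_apply hz]
    exact eq_comm

/-- The map v ↦ (0, e^{z·}v) is injective because evaluation at 0 recovers v. -/
theorem finrank_opEigenspace (hz : -η < z.re) :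
    Module.finrank ℂ (opEigenspace (opAL Lhat) z)
      = Module.finrank ℂ (LinearMap.ker (charMatrix Lhat z).mulVecLin) := by
  rw [opEigenspace_eq_map hz]
  refine (Submodule.equivMapOfInjective _ (fun v w h => ?_) _).finrank_eq.symm
  have h2 : expL η n z v = expL η n z w := congrArg Prod.snd h
  rw [expL_apply hz, expL_apply hz] at h2
  rw [← expFun_zeroPt hz v, h2, expFun_zeroPt]

/-- A resolvent at z would annihilate the zero image of an eigenvector and yet return that
eigenvector; so Δ(z) would be injective, and in finite dimension invertible. -/
theorem mem_opSpectrum_of_not_isUnit (hz : -η < z.re) (h : ¬ IsUnit (charOp Lhat z)) :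
    z ∈ opSpectrum (opAL Lhat) := by
  rintro ⟨R, hR⟩
  refine h ((isUnit_charOp_iff_injective hz).2 ((injective_iff_map_eq_zero _).2 fun v hv => ?_))
  obtain ⟨hx, hTx⟩ := (mem_opEigenspace_iff (Lhat := Lhat) hz (0, expFun hz v)).2 ⟨v, hv, rfl⟩
  have h0 := hR.2 ⟨_, hx⟩
  rw [hTx, sub_self, map_zero] at h0
  have h1 := congrArg (fun x : StateSpace η n => x.2 zeroPt) h0
  simpa using h1.symm

end Resolvent

/-! ### Laurent expansions at poles of order at most one. -/

section Laurent

variable {F : Type*} [NormedAddCommGroup F] [NormedSpace ℂ F] {f S : ℂ → F} {z₀ : ℂ}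

/-- Multiplication by z - z₀ turns the expansion into a power series with constant term `B (-1)`;
its sum is continuous at the centre. -/
theorem HasLaurentExpansion.tendsto_residue {B : ℤ → F} (h : HasLaurentExpansion f z₀ 1 B) :
    Tendsto (fun z => (z - z₀) • f z) (𝓝[≠] z₀) (𝓝 (B (-1))) := by
  classical
  let p : FormalMultilinearSeries ℂ ℂ F := fun m =>
    ContinuousMultilinearMap.mkPiRing ℂ (Fin m) (B ((m : ℤ) - 1))
  have hp : ∀ m, p.coeff m = B ((m : ℤ) - 1) := fun m => by
    simp [p, FormalMultilinearSeries.coeff, ContinuousMultilinearMap.mkPiRing_apply]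
  let g : ℂ → F := Function.update (fun z => (z - z₀) • f z) z₀ (B (-1))
  have hg : HasFPowerSeriesAt g p z₀ := by
    rw [hasFPowerSeriesAt_iff']
    refine (eventually_nhdsWithin_iff.1 h).mono fun z hz => ?_
    rcases eq_or_ne z z₀ with rfl | hne
    · convert hasSum_single (f := fun m : ℕ => (z - z) ^ m • p.coeff m) 0 fun m hm => ?_ using 1
      · simp [g, hp]
      · simp [hm]
    · have hne' : z - z₀ ≠ 0 := sub_ne_zero.2 hne
      convert (hz hne).const_smul (z - z₀) using 1
      · funext m
        rw [hp, smul_smul, Nat.cast_one, ← zpow_one_add₀ hne', add_sub_cancel, zpow_natCast]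
      · simp [g, hne]
  have h1 : Tendsto g (𝓝[≠] z₀) (𝓝 (B (-1))) := by
    have := hg.continuousAt.tendsto.mono_left (nhdsWithin_le_nhds (s := {z₀}ᶜ))
    simpa [g] using this
  refine h1.congr' ?_
  filter_upwards [self_mem_nhdsWithin] with z hz
  exact Function.update_of_ne hz _ _

theorem exists_hasLaurentExpansion (hS : AnalyticAt ℂ S z₀)
    (hf : ∀ᶠ z in 𝓝[≠] z₀, S z = (z - z₀) • f z) :
    ∃ B : ℤ → F, HasLaurentExpansion f z₀ 1 B ∧ B (-1) = S z₀ := by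
  obtain ⟨p, hp⟩ := hS
  -- Laurent index m corresponds to Taylor index m + 1 of (z - z₀)f. The truncation by `toNat`
  -- affects only m < -1, and those indices do not occur in the expansion.
  refine ⟨fun m => p.coeff (m + 1).toNat, ?_, ?_⟩
  · filter_upwards [(hasFPowerSeriesAt_iff'.1 hp).filter_mono nhdsWithin_le_nhds, hf,
      self_mem_nhdsWithin] with z hz hfz hne
    have hne' : z - z₀ ≠ 0 := sub_ne_zero.2 hne
    rw [hfz] at hz
    convert hz.const_smul (z - z₀)⁻¹ using 1
    · funext m
      rw [smul_smul, Nat.cast_one, sub_add_cancel, Int.toNat_natCast, zpow_sub₀ hne', zpow_one,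
        zpow_natCast, div_eq_inv_mul]
    · rw [smul_smul, inv_mul_cancel₀ hne', one_smul]
  · simpa using hp.coeff_zero (fun _ => 1)

theorem tendsto_sq_smul_of_tendsto_smul {y : F}
    (h : Tendsto (fun z => (z - z₀) • f z) (𝓝[≠] z₀) (𝓝 y)) :
    Tendsto (fun z => (z - z₀) ^ 2 • f z) (𝓝[≠] z₀) (𝓝 0) := by
  have hs : Tendsto (fun z : ℂ => z - z₀) (𝓝[≠] z₀) (𝓝 0) := by
    have : ContinuousAt (fun z : ℂ => z - z₀) z₀ := by fun_prop
    simpa using this.tendsto.mono_left (nhdsWithin_le_nhds (s := {z₀}ᶜ))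
  simpa only [pow_two, smul_smul, zero_smul] using hs.smul h

/-- By the removable singularity theorem (z - z₀)²f extends analytically with value 0 at z₀. A
factor z - z₀ can then be divided out. -/
theorem exists_analyticAt_of_tendsto_sq_smul [CompleteSpace F]
    (hd : ∀ᶠ z in 𝓝[≠] z₀, DifferentiableAt ℂ f z)
    (h : Tendsto (fun z => (z - z₀) ^ 2 • f z) (𝓝[≠] z₀) (𝓝 0)) :
    ∃ g : ℂ → F, AnalyticAt ℂ g z₀ ∧ ∀ᶠ z in 𝓝[≠] z₀, g z = (z - z₀) • f z := by
  classical
  let G : ℂ → F := Function.update (fun z => (z - z₀) ^ 2 • f z) z₀ 0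
  have hG : AnalyticAt ℂ G z₀ := by
    refine Complex.analyticAt_of_differentiable_on_punctured_nhds_of_continuousAt ?_
      (continuousAt_update_same.2 h)
    filter_upwards [hd, self_mem_nhdsWithin] with z hz hne
    have h1 : DifferentiableAt ℂ (fun z => (z - z₀) ^ 2 • f z) z := by fun_prop
    refine h1.congr_of_eventuallyEq ?_
    filter_upwards [isOpen_ne.mem_nhds hne] with w hw
    exact Function.update_of_ne hw _ _
  obtain ⟨p, hp⟩ := hG
  -- As G vanishes at z₀, its difference quotient there is G(z)/(z - z₀) = (z - z₀)f(z).
  refine ⟨dslope G z₀, ⟨_, hp.has_fpower_series_dslope_fslope⟩, ?_⟩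
  filter_upwards [self_mem_nhdsWithin] with z hne
  have hne' : z - z₀ ≠ 0 := sub_ne_zero.2 hne
  rw [dslope_of_ne _ hne, slope_def_module]
  simp only [G, Function.update_self, Function.update_of_ne hne, sub_zero, smul_smul]
  rw [pow_two, inv_mul_cancel_left₀ hne']

end Laurent

/-! ### Algebraic relations for the residue of an inverse operator family. -/

section Residue

variable {X : Type*} [NormedAddCommGroup X] [NormedSpace ℂ X]
  {C : ℂ → X →L[ℂ] X} {C' D : X →L[ℂ] X} {z₀ : ℂ}

theorem mul_residue_eq_zero (hC : HasDerivAt C C' z₀) (hu : ∀ᶠ z in 𝓝[≠] z₀, IsUnit (C z))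
    (hD : Tendsto (fun z => (z - z₀) • Ring.inverse (C z)) (𝓝[≠] z₀) (𝓝 D)) :
    C z₀ * D = 0 := by
  have hsub : Tendsto (fun z : ℂ => (z - z₀) • (1 : X →L[ℂ] X)) (𝓝[≠] z₀) (𝓝 0) := by
    have : ContinuousAt (fun z : ℂ => (z - z₀) • (1 : X →L[ℂ] X)) z₀ := by fun_prop
    simpa using this.tendsto.mono_left (nhdsWithin_le_nhds (s := {z₀}ᶜ))
  refine tendsto_nhds_unique
    ((hC.continuousAt.tendsto.mono_left nhdsWithin_le_nhds).mul hD) (hsub.congr' ?_)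
  filter_upwards [hu] with z hz
  rw [mul_smul_comm, Ring.mul_inverse_cancel _ hz]

theorem residue_mul_eq_zero (hC : HasDerivAt C C' z₀) (hu : ∀ᶠ z in 𝓝[≠] z₀, IsUnit (C z))
    (hD : Tendsto (fun z => (z - z₀) • Ring.inverse (C z)) (𝓝[≠] z₀) (𝓝 D)) :
    D * C z₀ = 0 := by
  have hsub : Tendsto (fun z : ℂ => (z - z₀) • (1 : X →L[ℂ] X)) (𝓝[≠] z₀) (𝓝 0) := by
    have : ContinuousAt (fun z : ℂ => (z - z₀) • (1 : X →L[ℂ] X)) z₀ := by fun_prop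
    simpa using this.tendsto.mono_left (nhdsWithin_le_nhds (s := {z₀}ᶜ))
  refine tendsto_nhds_unique
    (hD.mul (hC.continuousAt.tendsto.mono_left nhdsWithin_le_nhds)) (hsub.congr' ?_)
  filter_upwards [hu] with z hz
  rw [smul_mul_assoc, Ring.inverse_mul_cancel _ hz]

/-- Because M kills C(z₀), M times the difference quotient of C times (z - z₀)C(z)⁻¹ is M C(z)C(z)⁻¹
= M before passing to the limit. -/
theorem mul_deriv_mul_residue (hC : HasDerivAt C C' z₀) (hu : ∀ᶠ z in 𝓝[≠] z₀, IsUnit (C z))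
    (hD : Tendsto (fun z => (z - z₀) • Ring.inverse (C z)) (𝓝[≠] z₀) (𝓝 D))
    {M : X →L[ℂ] X} (hM : M * C z₀ = 0) : M * C' * D = M := by
  refine tendsto_nhds_unique
    (((hasDerivAt_iff_tendsto_slope.1 hC).const_mul M).mul hD) (tendsto_const_nhds.congr' ?_)
  filter_upwards [hu, self_mem_nhdsWithin] with z hz hne
  have hne' : z - z₀ ≠ 0 := sub_ne_zero.2 hne
  rw [slope_def_module, mul_smul_comm, mul_smul_comm, mul_sub, hM, sub_zero, smul_mul_assoc,
    smul_smul, mul_inv_cancel₀ hne', one_smul, mul_assoc, Ring.mul_inverse_cancel _ hz, mul_one]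

/-- The mirror image on the right: on a kernel vector v the difference quotient is C(z)v/(z - z₀),
which (z - z₀)C(z)⁻¹ sends back to v. -/
theorem residue_deriv_apply (hC : HasDerivAt C C' z₀) (hu : ∀ᶠ z in 𝓝[≠] z₀, IsUnit (C z))
    (hD : Tendsto (fun z => (z - z₀) • Ring.inverse (C z)) (𝓝[≠] z₀) (𝓝 D))
    {v : X} (hv : C z₀ v = 0) : D (C' v) = v := by
  have h1 := ((ContinuousLinearMap.apply ℂ X v).continuous.tendsto C').comp
    (hasDerivAt_iff_tendsto_slope.1 hC)
  refine tendsto_nhds_unique ((isBoundedBilinearMap_apply.continuous.tendsto (D, C' v)).comp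
    (hD.prodMk_nhds h1)) (tendsto_const_nhds.congr' ?_)
  filter_upwards [hu, self_mem_nhdsWithin] with z hz hne
  have hne' : z - z₀ ≠ 0 := sub_ne_zero.2 hne
  change v = ((z - z₀) • Ring.inverse (C z)) (slope C z₀ z v)
  rw [slope_def_module, smul_apply, smul_apply, sub_apply, hv, sub_zero, map_smul, smul_smul,
    mul_inv_cancel₀ hne', one_smul, ← mul_apply_eq_comp,
    Ring.inverse_mul_cancel _ hz]
  rfl

end Residue

/-! ### Transfer of poles and residues between Δ(z)⁻¹ and the resolvent. -/

section Simple

variable {η : ℝ} {n : ℕ} {Lhat : BUC η (Fin n → ℝ) →L[ℝ] (Fin n → ℝ)} {lam : ℂ}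

theorem differentiableAt_solOp {T : ℂ → (Fin n → ℂ) →L[ℂ] (Fin n → ℂ)} {c : ℂ → ℂ} {z : ℂ}
    (hz : -η < z.re) (hT : DifferentiableAt ℂ T z) (hc : DifferentiableAt ℂ c z) :
    DifferentiableAt ℂ (fun z => solOp Lhat z (T z) (c z)) z := by
  have hE := (hasDerivAt_expL (n := n) hz).differentiableAt
  have hK := (hasDerivAt_convL (n := n) hz).differentiableAt
  have hr : DifferentiableAt ℂ (charRhs Lhat) z :=
    ((((differentiableAt_const (complexifyL Lhat)).clm_comp hK).const_add _).clm_comp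
      (differentiableAt_const _)).const_add _
  exact (differentiableAt_const _).clm_comp ((hE.clm_comp (hT.clm_comp hr)).add
    (hc.smul (hK.clm_comp (differentiableAt_const _))))

theorem differentiableAt_inverse_charOp {z : ℂ} (hz : -η < z.re) (h : IsUnit (charOp Lhat z)) :
    DifferentiableAt ℂ (fun z => Ring.inverse (charOp Lhat z)) z :=
  DifferentiableAt.comp z (differentiableAt_inverse h) (hasDerivAt_charOp hz).differentiableAt

/-- An analytic extension of `(z - lam) Δ(z)⁻¹` gives an analytic extension of
`(z - lam) (z - (A + L))⁻¹`. -/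
theorem exists_analyticAt_smul_resolvent (hlam : -η < lam.re)
    {h : ℂ → (Fin n → ℂ) →L[ℂ] (Fin n → ℂ)} (han : AnalyticAt ℂ h lam)
    (hh : ∀ᶠ z in 𝓝[≠] lam, h z = (z - lam) • Ring.inverse (charOp Lhat z)) :
    AnalyticAt ℂ (fun z => solOp Lhat z (h z) (z - lam)) lam ∧
      ∀ᶠ z in 𝓝[≠] lam, solOp Lhat z (h z) (z - lam) = (z - lam) • opResolvent (opAL Lhat) z := by
  have hhalf := eventually_mem_halfPlane hlam
  constructor
  · refine Complex.analyticAt_iff_eventually_differentiableAt.2 ?_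
    filter_upwards [Complex.analyticAt_iff_eventually_differentiableAt.1 han, hhalf] with z h1 h2
    exact differentiableAt_solOp h2 h1 (by fun_prop)
  · filter_upwards [hh, hhalf.filter_mono nhdsWithin_le_nhds, eventually_isUnit_charOp hlam]
      with z h1 h2 h3
    rw [opResolvent_eq (isResolventAt_solOp h2 h3), smul_solOp, ← h1, mul_one]

/-- For the datum (α, 0) the convolution vanishes, and the resolvent gives e^{z·}Δ(z)⁻¹α. Evaluation
at 0 thus recovers Δ(z)⁻¹ by a continuous operation, under which the limit of (z - λ₀) times the
resolvent is preserved. -/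
theorem tendsto_smul_inverse_of_hasLaurentExpansion (hlam : -η < lam.re)
    {B : ℤ → (StateSpace η n →L[ℂ] StateSpace η n)}
    (hB : HasLaurentExpansion (opResolvent (opAL Lhat)) lam 1 B) :
    Tendsto (fun z => (z - lam) • Ring.inverse (charOp Lhat z)) (𝓝[≠] lam)
      (𝓝 (((evalZero η n).comp (ContinuousLinearMap.snd ℂ _ _)).comp
        ((B (-1)).comp (ContinuousLinearMap.inl ℂ _ _)))) := by
  have hcont : Continuous fun R : StateSpace η n →L[ℂ] StateSpace η n =>
      ((evalZero η n).comp (ContinuousLinearMap.snd ℂ _ _)).comp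
        (R.comp (ContinuousLinearMap.inl ℂ _ _)) := by fun_prop
  have h2 := (hcont.tendsto _).comp hB.tendsto_residue
  refine h2.congr' ?_
  filter_upwards [(eventually_mem_halfPlane hlam).filter_mono nhdsWithin_le_nhds,
    eventually_isUnit_charOp hlam] with z hz hu
  rw [Function.comp_apply, opResolvent_eq (isResolventAt_solOp hz hu), smul_solOp]
  ext1 v
  change (solOp Lhat z _ _ (v, 0)).2 zeroPt = _
  rw [solOp_apply hz, charRhs_apply hz, ← convL_apply hz, map_zero, map_zero]
  simp

/-- If `Δ(z)⁻¹` has at most a simple pole, then a nontrivial kernel of `Δ(lam)` makes `lam` a pole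
of order one of the resolvent. -/
theorem isResolventPole_one (hlam : -η < lam.re)
    (hlim : Tendsto (fun z => (z - lam) ^ 2 • Ring.inverse (charOp Lhat z)) (𝓝[≠] lam) (𝓝 0))
    (hker : ¬ IsUnit (charOp Lhat lam)) :
    IsResolventPole (opAL Lhat) lam 1 := by
  have hhalf := (eventually_mem_halfPlane hlam).filter_mono (nhdsWithin_le_nhds (s := {lam}ᶜ))
  have hunit := eventually_isUnit_charOp (Lhat := Lhat) hlam
  obtain ⟨h, han, hh⟩ := exists_analyticAt_of_tendsto_sq_smul
    ((hhalf.and hunit).mono fun z hz => differentiableAt_inverse_charOp hz.1 hz.2) hlim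
  obtain ⟨hS, hR⟩ := exists_analyticAt_smul_resolvent hlam han hh
  obtain ⟨B, hB, hB1⟩ := exists_hasLaurentExpansion hS hR
  refine ⟨le_rfl, mem_opSpectrum_of_not_isUnit hlam hker,
    (hhalf.and hunit).mono fun z hz => ⟨_, isResolventAt_solOp hz.1 hz.2⟩, B, hB, fun h0 => hker ?_⟩
  -- If the leading coefficient vanished, so would the residue D of Δ⁻¹. But DΔ'(λ₀)v = v on the
  -- kernel of Δ(λ₀), which would then be trivial.
  have hD := tendsto_smul_inverse_of_hasLaurentExpansion hlam hB
  rw [Nat.cast_one] at h0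
  rw [h0, ContinuousLinearMap.zero_comp, ContinuousLinearMap.comp_zero] at hD
  refine (isUnit_charOp_iff_injective hlam).2 ((injective_iff_map_eq_zero _).2 fun v hv => ?_)
  exact (residue_deriv_apply (hasDerivAt_charOp hlam) hunit hD hv).symm

/-- The residue of the resolvent in terms of the residue of `Δ(z)⁻¹`. -/
theorem residue_eq_solOp (hlam : -η < lam.re) {B : ℤ → (StateSpace η n →L[ℂ] StateSpace η n)}
    (hB : HasLaurentExpansion (opResolvent (opAL Lhat)) lam 1 B)
    {D : (Fin n → ℂ) →L[ℂ] (Fin n → ℂ)}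
    (hD : Tendsto (fun z => (z - lam) • Ring.inverse (charOp Lhat z)) (𝓝[≠] lam) (𝓝 D)) :
    B (-1) = solOp Lhat lam D 0 := by
  have hsq : Tendsto (fun z => (z - lam) ^ 2 • Ring.inverse (charOp Lhat z)) (𝓝[≠] lam) (𝓝 0) :=
    tendsto_sq_smul_of_tendsto_smul hD
  have hhalf := (eventually_mem_halfPlane hlam).filter_mono (nhdsWithin_le_nhds (s := {lam}ᶜ))
  have hunit := eventually_isUnit_charOp (Lhat := Lhat) hlam
  obtain ⟨h, han, hh⟩ := exists_analyticAt_of_tendsto_sq_smul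
    ((hhalf.and hunit).mono fun z hz => differentiableAt_inverse_charOp hz.1 hz.2) hsq
  obtain ⟨hS, hR⟩ := exists_analyticAt_smul_resolvent hlam han hh
  have hD' : h lam = D := tendsto_nhds_unique
    (han.continuousAt.tendsto.mono_left nhdsWithin_le_nhds) (hD.congr' (hh.mono fun _ => Eq.symm))
  have h1 := tendsto_nhds_unique (hS.continuousAt.tendsto.mono_left nhdsWithin_le_nhds)
    (hB.tendsto_residue.congr' (hR.mono fun _ => Eq.symm))
  -- The convolution term carries the factor z - λ₀, so it disappears at λ₀.
  rw [← h1, hD', sub_self]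

theorem solOp_residue_apply (hlam : -η < lam.re) (D : (Fin n → ℂ) →L[ℂ] (Fin n → ℂ))
    (y : StateSpace η n) :
    solOp Lhat lam D 0 y = (0, expFun hlam (D (charRhs Lhat lam y))) := by
  rw [solOp_apply hlam, zero_smul, add_zero]

theorem charRhs_eigenvector (hlam : -η < lam.re) (v : Fin n → ℂ) :
    charRhs Lhat lam (0, expFun hlam v) = charOpDeriv Lhat lam v := by
  rw [charRhs_apply hlam, zero_add, expFun_zeroPt, ← convL_apply hlam, ← expL_apply hlam]
  rfl

variable {D : (Fin n → ℂ) →L[ℂ] (Fin n → ℂ)}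

theorem solOp_residue_mem_opEigenspace (hlam : -η < lam.re)
    (hD : charOp Lhat lam * D = 0) (y : StateSpace η n) :
    solOp Lhat lam D 0 y ∈ opEigenspace (opAL Lhat) lam := by
  refine (mem_opEigenspace_iff hlam _).2 ⟨_, ?_, solOp_residue_apply hlam D y⟩
  exact congrArg (fun T : (Fin n → ℂ) →L[ℂ] (Fin n → ℂ) => T (charRhs Lhat lam y)) hD

/-- On an eigenvector e^{λ₀·}v the right-hand side of the characteristic equation is Δ'(λ₀)v, which
D maps to v. As the range also lies in the eigenspace, the residue is a projector onto it. -/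
theorem solOp_residue_eq_self (hlam : -η < lam.re)
    (hD : ∀ v, charOp Lhat lam v = 0 → D (charOpDeriv Lhat lam v) = v) {x : StateSpace η n}
    (hx : x ∈ opEigenspace (opAL Lhat) lam) : solOp Lhat lam D 0 x = x := by
  obtain ⟨v, hv, rfl⟩ := (mem_opEigenspace_iff hlam x).1 hx
  rw [solOp_residue_apply hlam, charRhs_eigenvector hlam, hD v hv]

end Simple

/-! ### Matrices of rank one and the normalization. -/

section RankOne

variable {n : ℕ}

/-- If the kernel of `N` is spanned by `V` and `N D = 0`, then `D = V Wᵀ` for some `W`. -/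
theorem exists_eq_vecMulVec {N D : Matrix (Fin n) (Fin n) ℂ} {V : Fin n → ℂ}
    (hV : V ≠ 0) (hNV : N.mulVec V = 0)
    (hN : Module.finrank ℂ (LinearMap.ker N.mulVecLin) = 1) (hND : N * D = 0) :
    ∃ W, D = Matrix.vecMulVec V W := by
  have hspan := (finrank_eq_one_iff_of_nonzero' (⟨V, hNV⟩ : LinearMap.ker N.mulVecLin)
    (fun h => hV (congrArg Subtype.val h))).1 hN
  have hcol : ∀ j, ∃ c : ℂ, c • V = D.col j := fun j => by
    have hj : N.mulVec (D.col j) = 0 := by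
      rw [← Matrix.mulVec_single_one, Matrix.mulVec_mulVec, hND, Matrix.zero_mulVec]
    obtain ⟨c, hc⟩ := hspan ⟨_, hj⟩
    exact ⟨c, congrArg Subtype.val hc⟩
  choose W hW using hcol
  refine ⟨W, Matrix.ext fun i j => ?_⟩
  rw [Matrix.vecMulVec_apply, mul_comm]
  exact (congrFun (hW j) i).symm

/-- Cancelling a nonzero entry of W in the normalization shows that VWᵀP fixes V. The columns of D
are multiples of V, so VWᵀPD = D, while `hMD` says that this product is VWᵀ. -/
theorem eq_vecMulVec_of_normalized {N P D : Matrix (Fin n) (Fin n) ℂ} {V W : Fin n → ℂ}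
    (hV : V ≠ 0) (hW : W ≠ 0) (hNV : N.mulVec V = 0)
    (hN : Module.finrank ℂ (LinearMap.ker N.mulVecLin) = 1) (hND : N * D = 0)
    (hM : Matrix.vecMulVec V W = Matrix.vecMulVec V W * P * Matrix.vecMulVec V W)
    (hMD : Matrix.vecMulVec V W * P * D = Matrix.vecMulVec V W) :
    D = Matrix.vecMulVec V W := by
  obtain ⟨U, rfl⟩ := exists_eq_vecMulVec hV hNV hN hND
  have h1 : (Matrix.vecMulVec V W * P).mulVec V = V := by
    obtain ⟨j, hj⟩ := Function.ne_iff.1 hW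
    rw [Matrix.mul_vecMulVec] at hM
    funext i
    exact (mul_right_cancel₀ hj (congrFun (congrFun hM i) j)).symm
  rw [Matrix.mul_vecMulVec, h1] at hMD
  exact hMD

end RankOne

end DelayEquation

end

theorem corollary6p1 (n : ℕ) (η : ℝ) (Lhat : BUC η (Fin n → ℝ) →L[ℝ] (Fin n → ℝ))
    (lam : ℂ) (hlam : -η < lam.re) :
    (IsSimpleEigenvalue (opAL Lhat) lam ↔
      Tendsto (fun z : ℂ => (z - lam) ^ 2 • (charMatrix Lhat z)⁻¹) (𝓝[≠] lam) (𝓝 0) ∧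
      Module.finrank ℂ (LinearMap.ker (charMatrix Lhat lam).mulVecLin) = 1) ∧
    (IsSimpleEigenvalue (opAL Lhat) lam →
      ∃ D : Matrix (Fin n) (Fin n) ℂ,
        Tendsto (fun z : ℂ => (z - lam) • (charMatrix Lhat z)⁻¹) (𝓝[≠] lam) (𝓝 D) ∧
        (∃ V W : Fin n → ℂ, V ≠ 0 ∧ W ≠ 0 ∧
          Matrix.vecMul W (charMatrix Lhat lam) = 0 ∧
          Matrix.mulVec (charMatrix Lhat lam) V = 0 ∧
          D = Matrix.vecMulVec V W) ∧
        D = D * (1 + hatMatrix Lhat (tailFun hlam)) * D ∧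
        (∀ V W : Fin n → ℂ, V ≠ 0 → W ≠ 0 →
          Matrix.vecMul W (charMatrix Lhat lam) = 0 →
          Matrix.mulVec (charMatrix Lhat lam) V = 0 →
          Matrix.vecMulVec V W = Matrix.vecMulVec V W *
            (1 + hatMatrix Lhat (tailFun hlam)) * Matrix.vecMulVec V W →
          D = Matrix.vecMulVec V W) ∧
        ∀ B : ℤ → (StateSpace η n →L[ℂ] StateSpace η n),
          HasLaurentExpansion (opResolvent (opAL Lhat)) lam 1 B →
          (∀ (α : Fin n → ℂ) (φ : BUC η (Fin n → ℂ)),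
            B (-1) (α, φ) =
              (0, expFun hlam (Matrix.mulVec D
                (α + φ zeroPt + complexify Lhat (convFun hlam φ))))) ∧
          (B (-1)).comp (B (-1)) = B (-1) ∧
          LinearMap.range (B (-1)).toLinearMap = opEigenspace (opAL Lhat) lam) := by
  have hhalf := (eventually_mem_halfPlane hlam).filter_mono (nhdsWithin_le_nhds (s := {lam}ᶜ))
  have hunit := eventually_isUnit_charOp (Lhat := Lhat) hlam
  have hC := hasDerivAt_charOp (Lhat := Lhat) hlam
  -- Matrix and operator agree only in the half plane, which suffices for limits at λ₀.
  have htend : ∀ (k : ℕ) (M : Matrix (Fin n) (Fin n) ℂ),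
      Tendsto (fun z : ℂ => (z - lam) ^ k • (charMatrix Lhat z)⁻¹) (𝓝[≠] lam) (𝓝 M) ↔
      Tendsto (fun z : ℂ => (z - lam) ^ k • Ring.inverse (charOp Lhat z)) (𝓝[≠] lam)
        (𝓝 (mulVecL M)) := fun k M => by
    rw [← tendsto_mulVecL_iff]
    refine tendsto_congr' (hhalf.mono fun z hz => ?_)
    beta_reduce
    rw [map_smul, mulVecL_inv, mulVecL_charMatrix hz]
  have hker_of_finrank :
      Module.finrank ℂ (LinearMap.ker (charMatrix Lhat lam).mulVecLin) = 1 →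
        ∃ V : Fin n → ℂ, V ≠ 0 ∧ (charMatrix Lhat lam).mulVec V = 0 := fun h => by
    obtain ⟨V, hV, -⟩ := finrank_eq_one_iff'.1 h
    exact ⟨V, fun h0 => hV (Subtype.ext h0), V.2⟩
  refine ⟨⟨fun h => ?_, fun h => ?_⟩, fun h => ?_⟩
  · obtain ⟨B, hB, -⟩ := h.1.expansion
    refine ⟨(htend 2 0).2 ?_, finrank_opEigenspace (Lhat := Lhat) hlam ▸ h.2⟩
    rw [map_zero]
    exact tendsto_sq_smul_of_tendsto_smul (tendsto_smul_inverse_of_hasLaurentExpansion hlam hB)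
  · obtain ⟨V, hV, hCV⟩ := hker_of_finrank h.2
    refine ⟨isResolventPole_one hlam ?_ fun hu => hV ?_, (finrank_opEigenspace hlam).trans h.2⟩
    · have := (htend 2 0).1 h.1
      rwa [map_zero] at this
    · rw [charMatrix_mulVec hlam] at hCV
      exact (injective_iff_map_eq_zero _).1 ((isUnit_charOp_iff_injective hlam).1 hu) V hCV
  · obtain ⟨B₀, hB₀, -⟩ := h.1.expansion
    have hfin := (finrank_opEigenspace (Lhat := Lhat) hlam).symm.trans h.2
    obtain ⟨D, hD⟩ : ∃ D : Matrix (Fin n) (Fin n) ℂ,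
        Tendsto (fun z => (z - lam) • Ring.inverse (charOp Lhat z)) (𝓝[≠] lam) (𝓝 (mulVecL D)) :=
      ⟨mulVecL.symm _, by
        rw [AlgEquiv.apply_symm_apply]
        exact tendsto_smul_inverse_of_hasLaurentExpansion hlam hB₀⟩
    have hP : mulVecL (1 + hatMatrix Lhat (tailFun hlam)) = charOpDeriv Lhat lam :=
      ContinuousLinearMap.ext (one_add_hatMatrix_tailFun_mulVec hlam)
    have hN := mulVecL_charMatrix (Lhat := Lhat) hlam
    have hinj := (mulVecL (n := n)).injective
    have hND : charMatrix Lhat lam * D = 0 := hinj (by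
      rw [map_mul, hN, map_zero, mul_residue_eq_zero hC hunit hD])
    have hDN : D * charMatrix Lhat lam = 0 := hinj (by
      rw [map_mul, hN, map_zero, residue_mul_eq_zero hC hunit hD])
    -- Used twice: M = D gives the normalization identity, and M = VWᵀ gives the uniqueness.
    have hMPD : ∀ M, M * charMatrix Lhat lam = 0 →
        M * (1 + hatMatrix Lhat (tailFun hlam)) * D = M := fun M hM => hinj (by
      rw [map_mul, map_mul, hP]
      refine mul_deriv_mul_residue hC hunit hD ?_
      rw [← hN, ← map_mul, hM, map_zero])
    have hDPv : ∀ v, charOp Lhat lam v = 0 → mulVecL D (charOpDeriv Lhat lam v) = v :=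
      fun v hv => residue_deriv_apply hC hunit hD hv
    refine ⟨D, ?_, ?_, (hMPD D hDN).symm, fun V W hV hW hWN hNV hM => ?_, fun B hB => ?_⟩
    · simpa only [pow_one] using (htend 1 D).2 (by simpa only [pow_one] using hD)
    · obtain ⟨V, hV, hNV⟩ := hker_of_finrank hfin
      obtain ⟨W, rfl⟩ := exists_eq_vecMulVec hV hNV hfin hND
      -- W = 0 would make D zero, contradicting DΔ'(λ₀)V = V.
      have hW : W ≠ 0 := by
        rintro rfl
        have h0 := hDPv V (by rwa [← charMatrix_mulVec hlam])
        rw [Matrix.vecMulVec_eq_zero.2 (Or.inr rfl), map_zero] at h0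
        exact hV h0.symm
      -- DΔ(λ₀) = V(WᵀΔ(λ₀)) = 0 with V ≠ 0 gives the left kernel relation.
      rw [Matrix.vecMulVec_mul] at hDN
      exact ⟨V, W, hV, hW, (Matrix.vecMulVec_eq_zero.1 hDN).resolve_left hV, hNV, rfl⟩
    · refine eq_vecMulVec_of_normalized hV hW hNV hfin hND hM (hMPD _ ?_)
      rw [Matrix.vecMulVec_mul, hWN, Matrix.vecMulVec_eq_zero]
      exact Or.inr rfl
    · have hB1 := residue_eq_solOp hlam hB hD
      have hmem := solOp_residue_mem_opEigenspace (D := mulVecL D) hlam (by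
        rw [← hN, ← map_mul, hND, map_zero])
      have hself := fun x => solOp_residue_eq_self (x := x) hlam hDPv
      rw [hB1]
      refine ⟨fun α φ => ?_, ?_, le_antisymm ?_ fun x hx => ⟨x, hself x hx⟩⟩
      · rw [solOp_residue_apply hlam, charRhs_apply hlam, mulVecL_apply]
      · exact ContinuousLinearMap.ext fun y => hself _ (hmem y)
      · rintro _ ⟨y, rfl⟩
        exact hmem y
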